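/- **Proposition 2.9 (Selberg's lemma).** Let $G$ be a connected real reductive Lie group with Lie algebra $\mathfrak g$, Cartan involution $\theta\in\mathrm{Aut}(G)$, and $K=\{k\in G:\theta(k)=k\}$; let $\mathfrak g=\mathfrak p\oplus\mathfrak k$ be the decomposition into the $(-1)$- and $(+1)$-eigenspaces of the differential of $\theta$. (As usual this means: $\theta$ is a smooth involutive automorphism of $G$; $K$ is compact; there is a nondegenerate symmetric bilinear form $B$ on $\mathfrak g$, invariant under $\mathrm{Ad}(G)$ and $\theta$, positive on $\mathfrak p$ and negative on $\mathfrak k$; and the Cartan decomposition $K\times\mathfrak p\to G$, $(k,a)\mapsto k e^{a}$, is a diffeomorphism.) An element $\gamma\in G$ is called semisimple if there exist $g\in G$, $a\in\mathfrak p$, $k\in K$ such that $\mathrm{Ad}(k)a=a$ and $\gamma=g\,e^{a}k^{-1}g^{-1}$. Let $\Gamma\subset G$ be a discrete cocompact subgroup, i.e. a discrete subgroup such that $\Gamma\backslash G$ is compact. Then every $\gamma\in\Gamma$ is semisimple, and, with $Z(\gamma)$ the centralizer of $\gamma$ in $G$, the subgroup $\Gamma\cap Z(\gamma)$ is cocompact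 in $Z(\gamma)$, i.e. $(\Gamma\cap Z(\gamma))\backslash Z(\gamma)$ is compact. -/

import Mathlib

open scoped Manifold ContDiff

noncomputable section

section LieGroupBasics

variable {E : Type*} [NormedAddCommGroup E] [NormedSpace ℝ E]
  {G : Type*} [TopologicalSpace G] [ChartedSpace E G] [Group G]

/-- The smooth curve `φ : ℝ → G` is the one-parameter subgroup with initial velocity `a`:
it is a group homomorphism from `(ℝ, +)` to `G` and `φ'(0) = a`. (Since `φ 0 = 1`, the tangent
vector `φ'(0)` lies in `T₁G`.) -/
def IsOneParameterSubgroup (φ : ℝ → G) (a : GroupLieAlgebra 𝓘(ℝ, E) G) : Prop :=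
  (∀ s t : ℝ, φ (s + t) = φ s * φ t) ∧
  ContMDiff 𝓘(ℝ, ℝ) 𝓘(ℝ, E) ∞ φ ∧
  (mfderiv 𝓘(ℝ, ℝ) 𝓘(ℝ, E) φ 0 (1 : ℝ) : E) = a

open Classical in
/-- The exponential map `a ↦ e^a` of a Lie group: the value at time `1` of the one-parameter
subgroup with initial velocity `a`. (In a Lie group this one-parameter subgroup exists and is
unique, so the value `1` of the `else` branch is never used.) -/
def lieExp (a : GroupLieAlgebra 𝓘(ℝ, E) G) : G :=
  if h : ∃ φ : ℝ → G, IsOneParameterSubgroup φ a then h.choose 1 else 1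

variable (E) in
/-- The adjoint representation: `lieAd E g` is the differential at `1` of `h ↦ g h g⁻¹`. -/
def lieAd (g : G) : GroupLieAlgebra 𝓘(ℝ, E) G →L[ℝ] GroupLieAlgebra 𝓘(ℝ, E) G :=
  mfderiv 𝓘(ℝ, E) 𝓘(ℝ, E) (fun h : G => g * h * g⁻¹) 1

variable (E) in
/-- The action of a group automorphism `θ` of `G` on the Lie algebra: its differential at `1`. -/
def lieDifferential (θ : G ≃* G) :
    GroupLieAlgebra 𝓘(ℝ, E) G →L[ℝ] GroupLieAlgebra 𝓘(ℝ, E) G :=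
  mfderiv 𝓘(ℝ, E) 𝓘(ℝ, E) θ 1

end LieGroupBasics

/-- The data `(θ, B)` that make a connected Lie group `G` a real reductive Lie group with Cartan
involution `θ` and invariant form `B`, in the standard sense of Knapp ("Lie groups beyond an
introduction", Section VII.2). With `K = {k | θ k = k}`, `𝔨 = {a | θ a = a}` and
`𝔭 = {a | θ a = -a}`, the group `K` is compact, `B` is positive on `𝔭` and negative on `𝔨`, and
`G = K exp 𝔭` is a global Cartan decomposition. (Reductivity of the Lie algebra is a consequence
of the existence of `B`.) -/
structure ReductiveStructure (E : Type*) [NormedAddCommGroup E] [NormedSpace ℝ E]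
    (G : Type*) [TopologicalSpace G] [ChartedSpace E G] [Group G] where
  /-- the Cartan involution of the group -/
  θ : G ≃* G
  θ_smooth : ContMDiff 𝓘(ℝ, E) 𝓘(ℝ, E) ∞ θ
  θ_involutive : ∀ g : G, θ (θ g) = g
  /-- the invariant bilinear form on the Lie algebra -/
  B : LinearMap.BilinForm ℝ (GroupLieAlgebra 𝓘(ℝ, E) G)
  B_symm : ∀ u v, B u v = B v u
  B_nondegenerate : B.Nondegenerate
  B_Ad : ∀ (g : G) (u v), B (lieAd E g u) (lieAd E g v) = B u v
  B_θ : ∀ u v, B (lieDifferential E θ u) (lieDifferential E θ v) = B u v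
  B_pos : ∀ u, lieDifferential E θ u = -u → u ≠ 0 → 0 < B u u
  B_neg : ∀ u, lieDifferential E θ u = u → u ≠ 0 → B u u < 0
  isCompact_fixed : IsCompact {k : G | θ k = k}
  /-- the Cartan decomposition `K × 𝔭 ≃ G`, `(k, a) ↦ k e^a` -/
  cartan_decomposition :
    IsHomeomorph (fun x : {k : G // θ k = k} ×
        {a : GroupLieAlgebra 𝓘(ℝ, E) G // lieDifferential E θ a = -a} =>
      (x.1 : G) * lieExp (x.2 : GroupLieAlgebra 𝓘(ℝ, E) G))

namespace ReductiveStructure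

variable {E : Type*} [NormedAddCommGroup E] [NormedSpace ℝ E]
  {G : Type*} [TopologicalSpace G] [ChartedSpace E G] [Group G]

/-- The subgroup `K` of `G` fixed by the Cartan involution. -/
def K (R : ReductiveStructure E G) : Subgroup G where
  carrier := {k | R.θ k = k}
  mul_mem' := by
    intro a b ha hb
    simp only [Set.mem_ofPred_eq] at ha hb ⊢
    rw [map_mul, ha, hb]
  one_mem' := map_one R.θ
  inv_mem' := by
    intro a ha
    simp only [Set.mem_ofPred_eq] at ha ⊢
    rw [map_inv, ha]

/-- The subspace `𝔭` of the Lie algebra on which the Cartan involution is `-1`. -/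
def 𝔭 (R : ReductiveStructure E G) : Submodule ℝ (GroupLieAlgebra 𝓘(ℝ, E) G) where
  carrier := {a | lieDifferential E R.θ a = -a}
  add_mem' := by
    intro a b ha hb
    simp only [Set.mem_ofPred_eq] at ha hb ⊢
    rw [map_add, ha, hb, neg_add]
  zero_mem' := by simp
  smul_mem' := by
    intro c a ha
    simp only [Set.mem_ofPred_eq] at ha ⊢
    rw [map_smul, ha, smul_neg]

/-- `γ` is semisimple if `γ = Ad(g)(e^a k⁻¹) = g e^a k⁻¹ g⁻¹` for some `g ∈ G`, `a ∈ 𝔭`, `k ∈ K`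
with `Ad(k) a = a`. -/
def IsSemisimple (R : ReductiveStructure E G) (γ : G) : Prop :=
  ∃ g : G, ∃ a ∈ R.𝔭, ∃ k ∈ R.K, lieAd E k a = a ∧ γ = g * (lieExp a * k⁻¹) * g⁻¹

end ReductiveStructure

/-- The subgroup `Δ` of the topological group `H` is cocompact: the space `Δ \ H` of cosets `Δ h`,
with the quotient topology, is compact. -/
def IsCocompactSubgroup {H : Type*} [Group H] [TopologicalSpace H] (Δ : Subgroup H) : Prop :=
  CompactSpace (Quotient (QuotientGroup.rightRel Δ))

end

/-! Write `Ad` in an orthonormal basis for `-B(·, θ ·)`. The Cartan involution becomes inverse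
transpose, `K` acts by orthogonal matrices and `exp 𝔭` by positive definite ones; since `G` is
connected, the kernel of `Ad` is central. Let `normSq g` be the squared Hilbert-Schmidt norm of `Ad
g`. `LinearizedCartan` records just the properties of this picture that are needed.

An element `k e^a` that minimizes `normSq` on its conjugacy class is semisimple: comparison with its
conjugate by `e^{a/2}` makes `Ad k` and `Ad e^a` commute, so `k` and `e^a` commute up to a central
element `z`. Compactness of `K` bounds the powers of `z`, and uniqueness of the Cartan decomposition
then forces `z = 1` (`exists_commuting_decomposition`).

The minimum is attained on the class of `γ ∈ Γ` (`exists_forall_normSq_le`). By cocompactness a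
minimizing sequence of conjugators is `δₙ cₙ` with `δₙ ∈ Γ` and `cₙ` in a compact set. As `Ad` is
proper only modulo its kernel, `δₙ⁻¹ γ δₙ` converges only after multiplication by central elements,
which may leave `Γ`. Its conjugation action on `Γ` ignores these elements, and it is eventually
constant because `Γ` is discrete and finitely generated. What remains is an element `w` centralizing
`Γ`; its conjugacy class is bounded in norm by cocompactness, so `w` acts orthogonally and does not
change `normSq`.

Cocompactness of `Γ ∩ Z(γ)` is independent of this: only finitely many `Γ`-conjugates of `γ` meet a
compact set. -/

section MatrixLemmas

/-! ### Symmetric and positive definite matrices: commutation and trace criteria. -/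

variable {ι : Type*} [Fintype ι] [DecidableEq ι]

/-- If `S` is symmetric and conjugating it by an orthogonal matrix does not decrease the pairing
`tr (S * ·)`, then the two commute. -/
theorem Matrix.commute_of_trace_mul_self_le {S U : Matrix ι ι ℝ} (hS : S.transpose = S)
    (hU : U.transpose * U = 1)
    (h : (S * S).trace ≤ (S * (U.transpose * S * U)).trace) : U * S = S * U := by
  have hU' : U * U.transpose = 1 := mul_eq_one_comm.mp hU
  set D := S - U.transpose * S * U with hD
  have hDt : D.conjTranspose = D := by
    rw [Matrix.conjTranspose_eq_transpose_of_trivial, hD, Matrix.transpose_sub,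
      Matrix.transpose_mul, Matrix.transpose_mul, Matrix.transpose_transpose, hS, mul_assoc]
  have h1 : (U.transpose * S * U * (U.transpose * S * U)).trace = (S * S).trace := by
    have : U.transpose * S * U * (U.transpose * S * U) = U.transpose * (S * S * U) := by
      calc _ = U.transpose * S * (U * U.transpose) * S * U := by noncomm_ring
        _ = _ := by rw [hU']; noncomm_ring
    rw [this, Matrix.trace_mul_comm, mul_assoc, hU', mul_one]
  have h2 : (U.transpose * S * U * S).trace = (S * (U.transpose * S * U)).trace :=
    Matrix.trace_mul_comm _ _
  -- The squared Frobenius norm of `S - Uᵀ S U`; the hypothesis makes it nonpositive, so the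
  -- difference vanishes.
  have h3 : (D.conjTranspose * D).trace = 2 * (S * S).trace
      - 2 * (S * (U.transpose * S * U)).trace := by
    rw [hDt, hD, sub_mul, mul_sub, mul_sub, Matrix.trace_sub, Matrix.trace_sub, Matrix.trace_sub,
      h1, h2]
    ring
  have h4 : 0 ≤ (D.conjTranspose * D).trace :=
    (Matrix.posSemidef_conjTranspose_mul_self D).trace_nonneg
  have h5 : D = 0 := Matrix.trace_conjTranspose_mul_self_eq_zero_iff.mp (by linarith)
  have h6 : S = U.transpose * S * U := sub_eq_zero.mp h5
  calc U * S = U * (U.transpose * S * U) := by rw [← h6]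
    _ = U * U.transpose * S * U := by noncomm_ring
    _ = S * U := by rw [hU', one_mul]

theorem Matrix.IsHermitian.ext_eigenvectorBasis {S : Matrix ι ι ℝ} (hS : S.IsHermitian)
    {A B : Matrix ι ι ℝ}
    (h : ∀ i j, (hS.eigenvectorBasis i).ofLp ⬝ᵥ (A.mulVec (hS.eigenvectorBasis j).ofLp)
      = (hS.eigenvectorBasis i).ofLp ⬝ᵥ (B.mulVec (hS.eigenvectorBasis j).ofLp)) : A = B := by
  have hlin : Matrix.toEuclideanLin A = Matrix.toEuclideanLin B := by
    refine hS.eigenvectorBasis.toBasis.ext fun j => ?_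
    refine InnerProductSpace.ext_inner_left_basis hS.eigenvectorBasis.toBasis fun i => ?_
    have := h i j
    simp only [OrthonormalBasis.coe_toBasis, EuclideanSpace.inner_eq_star_dotProduct]
    simp only [star_trivial, Matrix.ofLp_toLpLin, Matrix.toLin'_apply]
    rw [dotProduct_comm, this, dotProduct_comm]
  exact Matrix.toEuclideanLin.injective hlin

omit [DecidableEq ι] in
theorem abs_dotProduct_mulVec_le {A : Matrix ι ι ℝ} {R : ℝ} (hA : ∀ i j, |A i j| ≤ R)
    (u v : ι → ℝ) : |u ⬝ᵥ A.mulVec v| ≤ ∑ i, ∑ j, |u i| * (R * |v j|) := by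
  simp only [dotProduct, Matrix.mulVec, Finset.mul_sum]
  refine (Finset.abs_sum_le_sum_abs _ _).trans (Finset.sum_le_sum fun i _ => ?_)
  refine (Finset.abs_sum_le_sum_abs _ _).trans (Finset.sum_le_sum fun j _ => ?_)
  rw [abs_mul, abs_mul]
  gcongr
  exact hA i j

theorem pow_mulVec_of_eigen {A : Matrix ι ι ℝ} {v : ι → ℝ} {c : ℝ} (h : A.mulVec v = c • v)
    (n : ℕ) : (A ^ n).mulVec v = c ^ n • v := by
  induction n with
  | zero => simp
  | succ n ih => rw [pow_succ, ← Matrix.mulVec_mulVec, h, Matrix.mulVec_smul, ih, smul_smul,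
      pow_succ, mul_comm]

theorem Matrix.PosDef.inv_mulVec_eigenvectorBasis {S S' : Matrix ι ι ℝ} (hS : S.PosDef)
    (hinv : S' * S = 1) (j : ι) :
    S'.mulVec (hS.isHermitian.eigenvectorBasis j).ofLp
      = (hS.isHermitian.eigenvalues j)⁻¹ • (hS.isHermitian.eigenvectorBasis j).ofLp := by
  have h := hS.isHermitian.mulVec_eigenvectorBasis j
  have h2 := congrArg S'.mulVec h
  rw [Matrix.mulVec_mulVec, hinv, Matrix.one_mulVec, Matrix.mulVec_smul] at h2
  have h2' := congrArg ((hS.isHermitian.eigenvalues j)⁻¹ • ·) h2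
  simp only [smul_smul, inv_mul_cancel₀ (hS.eigenvalues_pos j).ne', one_smul] at h2'
  exact h2'.symm

/-- A matrix whose conjugates by all powers of a positive definite matrix `S` are bounded commutes
with `S`. -/
theorem Matrix.PosDef.commute_of_bounded_conj {S S' W : Matrix ι ι ℝ} (hS : S.PosDef)
    (hinv : S' * S = 1) {R : ℝ} (h1 : ∀ (n : ℕ) i j, |(S ^ n * W * S' ^ n) i j| ≤ R)
    (h2 : ∀ (n : ℕ) i j, |(S' ^ n * W * S ^ n) i j| ≤ R) : S * W = W * S := by
  refine hS.isHermitian.ext_eigenvectorBasis fun i j => ?_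
  set u := (hS.isHermitian.eigenvectorBasis i).ofLp
  set v := (hS.isHermitian.eigenvectorBasis j).ofLp
  set a := hS.isHermitian.eigenvalues i
  set b := hS.isHermitian.eigenvalues j
  have ha : 0 < a := hS.eigenvalues_pos i
  have hb : 0 < b := hS.eigenvalues_pos j
  have hu : S.mulVec u = a • u := hS.isHermitian.mulVec_eigenvectorBasis i
  have hv : S.mulVec v = b • v := hS.isHermitian.mulVec_eigenvectorBasis j
  have hu' : S'.mulVec u = a⁻¹ • u := hS.inv_mulVec_eigenvectorBasis hinv i
  have hv' : S'.mulVec v = b⁻¹ • v := hS.inv_mulVec_eigenvectorBasis hinv j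
  have hSt : S.transpose = S := by
    simpa [Matrix.conjTranspose_eq_transpose_of_trivial] using hS.isHermitian.eq
  have hSt' : S'.transpose = S' := by
    have h3 : S * S'.transpose = 1 := by
      rw [← hSt, ← Matrix.transpose_mul, hinv, Matrix.transpose_one]
    calc S'.transpose = S' * S * S'.transpose := by rw [hinv, one_mul]
      _ = S' := by rw [mul_assoc, h3, mul_one]
  -- In an eigenbasis of `S`, conjugation by `S ^ n` multiplies the `(i, j)` coefficient of `W` by
  -- `(a / b) ^ n`. If `a ≠ b`, one of the two signs of the exponent makes this unbounded, so the
  -- coefficient is zero.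
  have key : ∀ {P Q : Matrix ι ι ℝ} {p q : ℝ}, P.transpose = P → P.mulVec u = p • u →
      Q.mulVec v = q • v → ∀ n : ℕ, u ⬝ᵥ (P ^ n * W * Q ^ n).mulVec v
        = (p * q) ^ n * (u ⬝ᵥ W.mulVec v) := by
    intro P Q p q hP hPu hQv n
    rw [← Matrix.mulVec_mulVec, pow_mulVec_of_eigen hQv, ← Matrix.mulVec_mulVec,
      Matrix.dotProduct_mulVec, ← Matrix.mulVec_transpose, Matrix.transpose_pow, hP,
      pow_mulVec_of_eigen hPu, Matrix.mulVec_smul, smul_dotProduct, dotProduct_smul, smul_eq_mul,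
      smul_eq_mul, mul_pow]
    ring
  set c := u ⬝ᵥ W.mulVec v
  have hcomm : u ⬝ᵥ (S * W).mulVec v = a * c := by
    rw [← Matrix.mulVec_mulVec, Matrix.dotProduct_mulVec, ← Matrix.mulVec_transpose, hSt, hu,
      smul_dotProduct, smul_eq_mul]
  have hcomm' : u ⬝ᵥ (W * S).mulVec v = b * c := by
    rw [← Matrix.mulVec_mulVec, hv, Matrix.mulVec_smul, dotProduct_smul, smul_eq_mul]
  rw [hcomm, hcomm']
  set M := ∑ i, ∑ j, |u i| * (R * |v j|)
  have hb1 : ∀ n : ℕ, (a * b⁻¹) ^ n * |c| ≤ M := fun n => by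
    have := abs_dotProduct_mulVec_le (h1 n) u v
    rwa [key hSt hu hv', abs_mul, abs_of_nonneg (by positivity)] at this
  have hb2 : ∀ n : ℕ, (a⁻¹ * b) ^ n * |c| ≤ M := fun n => by
    have := abs_dotProduct_mulVec_le (h2 n) u v
    rwa [key hSt' hu' hv, abs_mul, abs_of_nonneg (by positivity)] at this
  have grow : ∀ x : ℝ, 1 < x → (∀ n : ℕ, x ^ n * |c| ≤ M) → c = 0 := by
    intro x hx hM
    by_contra hc
    have hc' : 0 < |c| := abs_pos.mpr hc
    obtain ⟨n, hn⟩ := pow_unbounded_of_one_lt (M / |c|) hx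
    rw [div_lt_iff₀ hc'] at hn
    exact absurd (hM n) (not_le.mpr hn)
  rcases lt_trichotomy a b with hab | hab | hab
  · rw [grow (a⁻¹ * b) (by rw [inv_mul_eq_div, one_lt_div ha]; exact hab) hb2]; simp
  · rw [hab]
  · rw [grow (a * b⁻¹) (by rw [← div_eq_mul_inv, one_lt_div hb]; exact hab) hb1]; simp

theorem Matrix.IsHermitian.trace_pow_eq_sum {S : Matrix ι ι ℝ} (hS : S.IsHermitian) (k : ℕ) :
    (S ^ k).trace = ∑ i, hS.eigenvalues i ^ k := by
  conv_lhs => rw [hS.spectral_theorem]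
  rw [← map_pow, Unitary.conjStarAlgAut_apply, Matrix.trace_mul_cycle, Unitary.coe_star_mul_self,
    one_mul, Matrix.diagonal_pow, Matrix.trace_diagonal]
  simp

/-- Each eigenvalue `x > 0` satisfies `x ^ k ≤ 1 + x ^ j`, by cases on `x ≤ 1`; this replaces
monotonicity of the powers. -/
theorem Matrix.PosDef.trace_pow_le {S : Matrix ι ι ℝ} (hS : S.PosDef) {k j : ℕ} (hkj : k ≤ j) :
    (S ^ k).trace ≤ Fintype.card ι + (S ^ j).trace := by
  rw [hS.isHermitian.trace_pow_eq_sum, hS.isHermitian.trace_pow_eq_sum, Fintype.card,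
    Finset.cast_card, ← Finset.sum_add_distrib]
  refine Finset.sum_le_sum fun i _ => ?_
  have hpos := hS.eigenvalues_pos i
  rcases le_total (hS.isHermitian.eigenvalues i) 1 with h | h
  · have h1 := pow_le_one₀ (n := k) hpos.le h
    have h2 := pow_pos hpos j
    linarith
  · have := pow_le_pow_right₀ h hkj
    linarith

/-- A positive definite matrix all of whose powers, with positive or negative exponents, have
bounded trace is the identity. -/
theorem Matrix.PosDef.eq_one_of_trace_pow_le {S S' : Matrix ι ι ℝ} (hS : S.PosDef)
    (hS' : S'.PosDef) (hinv : S' * S = 1) {R : ℝ} (h1 : ∀ k : ℕ, (S ^ k).trace ≤ R)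
    (h2 : ∀ k : ℕ, (S' ^ k).trace ≤ R) : S = 1 := by
  have small : ∀ {T : Matrix ι ι ℝ} (hT : T.PosDef), (∀ k : ℕ, (T ^ k).trace ≤ R) →
      ∀ i, hT.isHermitian.eigenvalues i ≤ 1 := by
    intro T hT h i
    by_contra! hi
    obtain ⟨n, hn⟩ := pow_unbounded_of_one_lt R hi
    have h3 := h n
    rw [hT.isHermitian.trace_pow_eq_sum] at h3
    have h4 := Finset.single_le_sum (f := fun i => hT.isHermitian.eigenvalues i ^ n)
      (fun j _ => (pow_pos (hT.eigenvalues_pos j) n).le) (Finset.mem_univ i)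
    linarith
  have hdiag : ∀ j, hS.isHermitian.eigenvalues j = 1 := by
    intro j
    refine le_antisymm (small hS h1 j) ?_
    by_contra! hlt
    have hpos := hS.eigenvalues_pos j
    have hv : (hS.isHermitian.eigenvectorBasis j).ofLp ⬝ᵥ
        (hS.isHermitian.eigenvectorBasis j).ofLp = 1 := by
      have := hS.isHermitian.eigenvectorBasis.inner_eq_one j
      rw [EuclideanSpace.inner_eq_star_dotProduct] at this
      simpa using this
    have hev := hS.inv_mulVec_eigenvectorBasis hinv j
    have hmem : (hS.isHermitian.eigenvalues j)⁻¹ ∈ spectrum ℝ S' := by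
      rw [← Matrix.spectrum_toLin']
      refine Module.End.HasEigenvalue.mem_spectrum (Module.End.hasEigenvalue_of_hasEigenvector
        (x := (hS.isHermitian.eigenvectorBasis j).ofLp) ⟨?_, ?_⟩)
      · rw [Module.End.mem_eigenspace_iff, Matrix.toLin'_apply, hev]
      · intro h0; rw [h0] at hv; simp at hv
    rw [hS'.isHermitian.spectrum_real_eq_range_eigenvalues] at hmem
    obtain ⟨i, hi⟩ := hmem
    have h5 := small hS' h2 i
    rw [hi] at h5
    exact absurd h5 (not_le.mpr ((one_lt_inv₀ hpos).mpr hlt))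
  refine hS.isHermitian.ext_eigenvectorBasis fun i j => ?_
  rw [hS.isHermitian.mulVec_eigenvectorBasis, hdiag, one_smul, Matrix.one_mulVec]

end MatrixLemmas

/-! ### Derivatives of maps between manifolds, read in the model spaces. -/

section ModelDerivative

variable {E : Type*} [NormedAddCommGroup E] [NormedSpace ℝ E]
  {F : Type*} [NormedAddCommGroup F] [NormedSpace ℝ F]
  {F' : Type*} [NormedAddCommGroup F'] [NormedSpace ℝ F']
  {M : Type*} [TopologicalSpace M] [ChartedSpace E M]
  {N : Type*} [TopologicalSpace N] [ChartedSpace F N]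
  {N' : Type*} [TopologicalSpace N'] [ChartedSpace F' N']

variable (E F) in
/-- The manifold derivative between boundaryless manifolds, as a map between the model spaces. -/
noncomputable def modelDeriv (f : M → N) (x : M) : E →L[ℝ] F := mfderiv 𝓘(ℝ, E) 𝓘(ℝ, F) f x

theorem modelDeriv_comp {g : N → N'} {f : M → N} {x : M} {y : N} (hy : f x = y)
    (hg : MDifferentiableAt 𝓘(ℝ, F) 𝓘(ℝ, F') g y) (hf : MDifferentiableAt 𝓘(ℝ, E) 𝓘(ℝ, F) f x) :
    modelDeriv E F' (fun z => g (f z)) x = (modelDeriv F F' g y).comp (modelDeriv E F f x) := by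
  subst hy
  exact mfderiv_comp x hg hf

theorem modelDeriv_id (x : M) : modelDeriv E E (fun z : M => z) x = ContinuousLinearMap.id ℝ E :=
  mfderiv_id

theorem modelDeriv_const (x : M) (c : N) : modelDeriv E F (fun _ : M => c) x = 0 :=
  mfderiv_const

/-- A map with vanishing derivative on a connected manifold is constant. -/
theorem eq_of_modelDeriv_eq_zero [IsManifold 𝓘(ℝ, E) 1 M] [IsManifold 𝓘(ℝ, F) 1 N]
    [PreconnectedSpace M] {u : M → N}
    (hu : MDifferentiable 𝓘(ℝ, E) 𝓘(ℝ, F) u) (h : ∀ x, modelDeriv E F u x = 0) (x y : M) :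
    u x = u y := by
  refine IsLocallyConstant.apply_eq_of_preconnectedSpace ?_ x y
  rw [IsLocallyConstant.iff_eventually_eq]
  intro x
  set c := chartAt E x
  set d := chartAt F (u x)
  set V : Set M := c.source ∩ u ⁻¹' d.source
  have hcont : Continuous u := hu.continuous
  have hV : IsOpen V := c.open_source.inter (d.open_source.preimage hcont)
  have hxV : x ∈ V := ⟨mem_chart_source E x, mem_chart_source F (u x)⟩
  have hW : IsOpen (c '' V) := c.isOpen_image_of_subset_source hV Set.inter_subset_left
  obtain ⟨r, hr, hball⟩ := Metric.isOpen_iff.mp hW (c x) ⟨x, hxV, rfl⟩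
  set f : E → F := fun z => d (u (c.symm z))
  have hf : ∀ z ∈ Metric.ball (c x) r, HasFDerivAt f (0 : E →L[ℝ] F) z := by
    intro z hz
    obtain ⟨p, hp, rfl⟩ := hball hz
    have hpz : c.symm (c p) = p := c.left_inv hp.1
    have h1 : MDifferentiableAt 𝓘(ℝ, E) 𝓘(ℝ, E) c.symm (c p) :=
      mdifferentiableAt_atlas_symm (chart_mem_atlas E x) (c.map_source hp.1)
    have h2 : MDifferentiableAt 𝓘(ℝ, F) 𝓘(ℝ, F) d (u p) :=
      mdifferentiableAt_atlas (chart_mem_atlas F (u x)) hp.2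
    have h3 : MDifferentiableAt 𝓘(ℝ, E) 𝓘(ℝ, F) (fun q => d (u q)) p := h2.comp p (hu p)
    have h4 : MDifferentiableAt 𝓘(ℝ, E) 𝓘(ℝ, F) f (c p) := by
      have h3' : MDifferentiableAt 𝓘(ℝ, E) 𝓘(ℝ, F) (fun q => d (u q)) (c.symm (c p)) := by
        rw [hpz]; exact h3
      exact h3'.comp _ h1
    have h5 : modelDeriv E F f (c p) = 0 := by
      have e1 := modelDeriv_comp (g := fun q => d (u q)) hpz h3 h1
      have e2 := modelDeriv_comp (g := d) (f := u) (x := p) rfl h2 (hu p)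
      rw [h, ContinuousLinearMap.comp_zero] at e2
      rw [e2, ContinuousLinearMap.zero_comp] at e1
      exact e1
    have h6 : fderiv ℝ f (c p) = 0 := by
      rw [← mfderiv_eq_fderiv]; exact h5
    rw [← h6]
    exact h4.differentiableAt.hasFDerivAt
  have hconst : ∀ z ∈ Metric.ball (c x) r, f z = f (c x) := by
    intro z hz
    refine Metric.isOpen_ball.is_const_of_fderiv_eq_zero (convex_ball _ _).isPreconnected
      (fun z hz => (hf z hz).differentiableAt.differentiableWithinAt)
      (fun z hz => (hf z hz).fderiv) hz (Metric.mem_ball_self hr)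
  have hnear : ∀ᶠ y in nhds x, y ∈ V ∧ c y ∈ Metric.ball (c x) r :=
    (hV.eventually_mem hxV).and ((c.continuousAt hxV.1).eventually (Metric.ball_mem_nhds _ hr))
  filter_upwards [hnear] with y hy
  have := hconst _ hy.2
  simp only [f, c.left_inv hy.1.1, c.left_inv hxV.1] at this
  exact d.injOn hy.1.2 hxV.2 this

end ModelDerivative

/-! ### Maps into Lie groups determined by one derivative. -/

section LieGroup

variable {E : Type*} [NormedAddCommGroup E] [NormedSpace ℝ E]
  {F : Type*} [NormedAddCommGroup F] [NormedSpace ℝ F]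
  {M : Type*} [TopologicalSpace M] [ChartedSpace F M]
  {G : Type*} [TopologicalSpace G] [ChartedSpace E G] [Group G] [LieGroup 𝓘(ℝ, E) ∞ G]

theorem mdifferentiable_mul_left_right (x y : G) :
    MDifferentiable 𝓘(ℝ, E) 𝓘(ℝ, E) (fun g : G => x * g * y) :=
  ((contMDiff_mul_right (I := 𝓘(ℝ, E)) (n := ∞) (a := y)).comp
    (contMDiff_mul_left (I := 𝓘(ℝ, E)) (n := ∞) (a := x))).mdifferentiable (by simp)

theorem modelDeriv_mul {f g : M → G} {m : M} (hf : MDifferentiableAt 𝓘(ℝ, F) 𝓘(ℝ, E) f m)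
    (hg : MDifferentiableAt 𝓘(ℝ, F) 𝓘(ℝ, E) g m) (hf1 : f m = 1) (hg1 : g m = 1) :
    modelDeriv F E (fun x => f x * g x) m = modelDeriv F E f m + modelDeriv F E g m := by
  have hmul : MDifferentiableAt (𝓘(ℝ, E).prod 𝓘(ℝ, E)) 𝓘(ℝ, E) (fun p : G × G => p.1 * p.2)
      (f m, g m) :=
    (contMDiff_mul 𝓘(ℝ, E) ∞).mdifferentiableAt (by simp)
  have h2 : modelDeriv E E (fun z : G => z * g m) (f m) = ContinuousLinearMap.id ℝ E := by
    simp only [hg1, mul_one]; exact modelDeriv_id _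
  have h3 : modelDeriv E E (fun z : G => f m * z) (g m) = ContinuousLinearMap.id ℝ E := by
    simp only [hf1, one_mul]; exact modelDeriv_id _
  refine ContinuousLinearMap.ext fun v => ?_
  have h1 := (congrArg (fun L => L v) (mfderiv_comp m hmul (hf.prodMk hg))).trans
    (mfderiv_prod_eq_add_apply hmul)
  have h4 := congrArg (fun L => L v) (mfderiv_prodMk hf hg)
  refine h1.trans ?_
  exact congrArg₂ (· + ·)
    ((congrArg (fun w : E × E => modelDeriv E E (fun z : G => z * g m) (f m) w.1) h4).trans
      (congrArg (fun L => L (modelDeriv F E f m v)) h2))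
    ((congrArg (fun w : E × E => modelDeriv E E (fun z : G => f m * z) (g m) w.2) h4).trans
      (congrArg (fun L => L (modelDeriv F E g m v)) h3))

theorem modelDeriv_inv {f : M → G} {m : M} (hf : MDifferentiableAt 𝓘(ℝ, F) 𝓘(ℝ, E) f m)
    (hf1 : f m = 1) : modelDeriv F E (fun x => (f x)⁻¹) m = -modelDeriv F E f m := by
  have hinv : MDifferentiableAt 𝓘(ℝ, F) 𝓘(ℝ, E) (fun x => (f x)⁻¹) m :=
    ((contMDiff_inv 𝓘(ℝ, E) ∞).mdifferentiableAt (by simp)).comp m hf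
  have h := modelDeriv_mul hf hinv hf1 (by rw [hf1, inv_one])
  simp only [mul_inv_cancel, modelDeriv_const] at h
  exact (neg_eq_of_add_eq_zero_right h.symm).symm

/-- A map into a Lie group which is, around any point, a translate of its germ at `m₀`, and whose
derivative at `m₀` vanishes, is constant. -/
theorem eq_of_translate_of_modelDeriv_eq_zero [IsManifold 𝓘(ℝ, F) 1 M] [PreconnectedSpace M]
    {u : M → G} (hu : MDifferentiable 𝓘(ℝ, F) 𝓘(ℝ, E) u) {m₀ : M} (h₀ : modelDeriv F E u m₀ = 0)
    (htrans : ∀ m, ∃ (τ : M → M) (x y : G), MDifferentiable 𝓘(ℝ, F) 𝓘(ℝ, F) τ ∧ τ m = m₀ ∧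
      ∀ p, u p = x * u (τ p) * y) (m m' : M) : u m = u m' := by
  have : IsManifold 𝓘(ℝ, E) 1 G := IsManifold.of_le (n := ∞) (by exact_mod_cast le_top)
  refine eq_of_modelDeriv_eq_zero hu (fun m => ?_) m m'
  obtain ⟨τ, x, y, hτ, hm, hp⟩ := htrans m
  have e : u = fun p => (fun g : G => x * g * y) (u (τ p)) := funext hp
  rw [e, modelDeriv_comp (g := fun g : G => x * g * y) (f := fun p => u (τ p)) rfl
    (mdifferentiable_mul_left_right x y _) ((hu _).comp _ (hτ _)),
    modelDeriv_comp hm (hu _) (hτ _), h₀]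
  simp

/-- A homomorphism of a connected Lie group into a Lie group is determined by its
differential. -/
theorem MonoidHom.eq_of_modelDeriv_eq [PreconnectedSpace G] {φ ψ : G →* G}
    (hφ : MDifferentiable 𝓘(ℝ, E) 𝓘(ℝ, E) φ) (hψ : MDifferentiable 𝓘(ℝ, E) 𝓘(ℝ, E) ψ)
    (h : modelDeriv E E φ 1 = modelDeriv E E ψ 1) (g : G) : φ g = ψ g := by
  have : IsManifold 𝓘(ℝ, E) 1 G := IsManifold.of_le (n := ∞) (by exact_mod_cast le_top)
  have hψi : MDifferentiable 𝓘(ℝ, E) 𝓘(ℝ, E) (fun x => (ψ x)⁻¹) :=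
    ((contMDiff_inv 𝓘(ℝ, E) ∞).mdifferentiable (by simp)).comp hψ
  have hu : MDifferentiable 𝓘(ℝ, E) 𝓘(ℝ, E) (fun x => φ x * (ψ x)⁻¹) :=
    ((contMDiff_mul 𝓘(ℝ, E) ∞).mdifferentiable (by simp)).comp (hφ.prodMk hψi)
  have key := eq_of_translate_of_modelDeriv_eq_zero hu (m₀ := 1) ?_ (fun m => ?_) g 1
  · simpa [mul_inv_eq_one] using key
  · rw [modelDeriv_mul (hφ 1) (hψi 1) (map_one φ) (by simp), modelDeriv_inv (hψ 1) (map_one ψ), h,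
      add_neg_cancel]
  · refine ⟨fun p => m⁻¹ * p, φ m, (ψ m)⁻¹, ?_, inv_mul_cancel m, fun p => ?_⟩
    · exact (contMDiff_mul_left (I := 𝓘(ℝ, E)) (n := ∞)).mdifferentiable (by simp)
    · simp [mul_assoc]

end LieGroup

/-! ### One-parameter subgroups and the adjoint representation. -/

section OneParameterSubgroup

variable {E : Type*} [NormedAddCommGroup E] [NormedSpace ℝ E]
  {G : Type*} [TopologicalSpace G] [ChartedSpace E G] [Group G]

/-- The adjoint representation on the model space. -/
noncomputable def modelAd (E : Type*) [NormedAddCommGroup E] [NormedSpace ℝ E] {G : Type*}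
    [TopologicalSpace G] [ChartedSpace E G] [Group G] (g : G) : E →L[ℝ] E := lieAd E g

/-- The exponential map on the model space. -/
noncomputable def modelExp {E : Type*} [NormedAddCommGroup E] [NormedSpace ℝ E] (G : Type*)
    [TopologicalSpace G] [ChartedSpace E G] [Group G] (a : E) : G :=
  lieExp (a : GroupLieAlgebra 𝓘(ℝ, E) G)

/-- `φ` is the one-parameter subgroup with initial velocity `a` in the model space. -/
def IsOneParam (φ : ℝ → G) (a : E) : Prop :=
  IsOneParameterSubgroup φ (a : GroupLieAlgebra 𝓘(ℝ, E) G)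

theorem modelAd_eq (g : G) : modelAd E g = modelDeriv E E (fun h : G => g * h * g⁻¹) 1 := rfl

namespace IsOneParam

variable {φ ψ : ℝ → G} {a b : E}

theorem map_add (h : IsOneParam φ a) (s t : ℝ) : φ (s + t) = φ s * φ t := h.1 s t

theorem contMDiff (h : IsOneParam φ a) : ContMDiff 𝓘(ℝ, ℝ) 𝓘(ℝ, E) ∞ φ := h.2.1

theorem mdifferentiable (h : IsOneParam φ a) : MDifferentiable 𝓘(ℝ, ℝ) 𝓘(ℝ, E) φ :=
  h.contMDiff.mdifferentiable (by simp)

theorem velocity (h : IsOneParam φ a) : modelDeriv ℝ E φ 0 1 = a := h.2.2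

theorem mk (h : ∀ s t : ℝ, φ (s + t) = φ s * φ t) (h' : ContMDiff 𝓘(ℝ, ℝ) 𝓘(ℝ, E) ∞ φ)
    (h'' : modelDeriv ℝ E φ 0 1 = a) : IsOneParam φ a := ⟨h, h', h''⟩

theorem map_zero (h : IsOneParam φ a) : φ 0 = 1 := by
  have := h.map_add 0 0
  rw [add_zero] at this
  exact left_eq_mul.mp this

theorem map_neg (h : IsOneParam φ a) (t : ℝ) : φ (-t) = (φ t)⁻¹ := by
  rw [eq_inv_iff_mul_eq_one, ← h.map_add, neg_add_cancel, h.map_zero]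

theorem comp_mul (h : IsOneParam φ a) (c : ℝ) : IsOneParam (fun t => φ (c * t)) (c • a) := by
  have hsm : ContMDiff 𝓘(ℝ, ℝ) 𝓘(ℝ, ℝ) ∞ (fun t : ℝ => c * t) :=
    (contDiff_const.mul contDiff_id).contMDiff
  refine mk (fun s t => by rw [mul_add, h.map_add]) (h.contMDiff.comp hsm) ?_
  have hd : modelDeriv ℝ ℝ (fun t : ℝ => c * t) 0 1 = c := by
    have h1 : HasFDerivAt (fun t : ℝ => c * t) _ 0 :=
      ((hasDerivAt_id (0 : ℝ)).const_mul c).hasFDerivAt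
    have h2 : modelDeriv ℝ ℝ (fun t : ℝ => c * t) 0 = _ := mfderiv_eq_fderiv.trans h1.fderiv
    rw [h2]
    simp
  rw [modelDeriv_comp (mul_zero c) (h.mdifferentiable 0) (hsm.mdifferentiable (by simp) 0),
    ContinuousLinearMap.comp_apply, hd]
  rw [← h.velocity, ← map_smul, smul_eq_mul, mul_one]

theorem comp_hom (h : IsOneParam φ a) {θ : G → G} (hθ : ∀ x y, θ (x * y) = θ x * θ y)
    (hθs : ContMDiff 𝓘(ℝ, E) 𝓘(ℝ, E) ∞ θ) :
    IsOneParam (fun t => θ (φ t)) (modelDeriv E E θ 1 a) := by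
  refine mk (fun s t => by rw [h.map_add, hθ]) (hθs.comp h.contMDiff) ?_
  rw [modelDeriv_comp h.map_zero (hθs.mdifferentiable (by simp) _) (h.mdifferentiable 0),
    ContinuousLinearMap.comp_apply, h.velocity]

theorem inv (h : IsOneParam φ a) : IsOneParam (fun t => (φ t)⁻¹) (-a) := by
  have := h.comp_mul (-1)
  simpa [h.map_neg] using this

theorem const : IsOneParam (fun _ : ℝ => (1 : G)) (0 : E) :=
  mk (fun _ _ => (mul_one 1).symm) contMDiff_const (by rw [modelDeriv_const]; rfl)

variable [LieGroup 𝓘(ℝ, E) ∞ G]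

/-- The quotient `u = φ ψ⁻¹` has zero derivative at `0`, and `u p = φ m * u (p - m) * (ψ m)⁻¹`
carries this to every `m`, so `u` is constant. -/
theorem unique (h : IsOneParam φ a) (h' : IsOneParam ψ a) (t : ℝ) : φ t = ψ t := by
  have hψi : MDifferentiable 𝓘(ℝ, ℝ) 𝓘(ℝ, E) (fun x => (ψ x)⁻¹) :=
    ((contMDiff_inv 𝓘(ℝ, E) ∞).mdifferentiable (by simp)).comp h'.mdifferentiable
  have hu : MDifferentiable 𝓘(ℝ, ℝ) 𝓘(ℝ, E) (fun x => φ x * (ψ x)⁻¹) :=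
    ((contMDiff_mul 𝓘(ℝ, E) ∞).mdifferentiable (by simp)).comp (h.mdifferentiable.prodMk hψi)
  have key := eq_of_translate_of_modelDeriv_eq_zero hu (m₀ := 0) ?_ (fun m => ?_) t 0
  · simpa [mul_inv_eq_one, h.map_zero, h'.map_zero] using key
  · rw [modelDeriv_mul (h.mdifferentiable 0) (hψi 0) h.map_zero (by simp [h'.map_zero]),
      modelDeriv_inv (h'.mdifferentiable 0) h'.map_zero]
    ext
    simp [h.velocity, h'.velocity]
  · refine ⟨fun p => -m + p, φ m, (ψ m)⁻¹, ?_, neg_add_cancel m, fun p => ?_⟩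
    · exact (contDiff_const.add contDiff_id : ContDiff ℝ ∞ _).contMDiff.mdifferentiable (by simp)
    · rw [h.map_add, h'.map_add, h.map_neg, h'.map_neg]
      group

theorem modelExp_eq (h : IsOneParam φ a) : modelExp G a = φ 1 := by
  have hex : ∃ φ : ℝ → G, IsOneParameterSubgroup φ (a : GroupLieAlgebra 𝓘(ℝ, E) G) := ⟨φ, h⟩
  have h1 : modelExp G a = hex.choose 1 := dif_pos hex
  rw [h1]
  exact IsOneParam.unique (a := a) hex.choose_spec h 1

theorem eq_modelExp (h : IsOneParam φ a) (t : ℝ) : φ t = modelExp G (t • a) := by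
  rw [(h.comp_mul t).modelExp_eq, mul_one]

theorem conj (h : IsOneParam φ a) (x : G) :
    IsOneParam (fun t => x * φ t * x⁻¹) (modelAd E x a) :=
  h.comp_hom (θ := fun g => x * g * x⁻¹) (fun y z => by group)
    ((contMDiff_mul_right (I := 𝓘(ℝ, E)) (n := ∞) (a := x⁻¹)).comp
      (contMDiff_mul_left (I := 𝓘(ℝ, E)) (n := ∞) (a := x)))

theorem mul (h : IsOneParam φ a) (h' : IsOneParam ψ b) (hc : ∀ s t, Commute (φ s) (ψ t)) :
    IsOneParam (fun t => φ t * ψ t) (a + b) := by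
  refine mk (fun s t => ?_) ((contMDiff_mul 𝓘(ℝ, E) ∞).comp (h.contMDiff.prodMk h'.contMDiff)) ?_
  · rw [h.map_add, h'.map_add, mul_assoc, mul_assoc, ← mul_assoc (φ t), (hc t s).eq, mul_assoc]
  · rw [modelDeriv_mul (h.mdifferentiable 0) (h'.mdifferentiable 0) h.map_zero h'.map_zero,
      add_apply, h.velocity, h'.velocity]

end IsOneParam

variable [LieGroup 𝓘(ℝ, E) ∞ G]

theorem contMDiff_conj (g : G) : ContMDiff 𝓘(ℝ, E) 𝓘(ℝ, E) ∞ (fun h : G => g * h * g⁻¹) :=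
  (contMDiff_mul_right (I := 𝓘(ℝ, E)) (n := ∞) (a := g⁻¹)).comp
      (contMDiff_mul_left (I := 𝓘(ℝ, E)) (n := ∞) (a := g))

omit [LieGroup 𝓘(ℝ, E) ∞ G] in
theorem modelAd_one : modelAd E (1 : G) = ContinuousLinearMap.id ℝ E := by
  rw [modelAd_eq]
  simpa using modelDeriv_id (E := E) (1 : G)

theorem modelAd_mul (g h : G) : modelAd E (g * h) = (modelAd E g).comp (modelAd E h) := by
  have e : (fun x : G => g * h * x * (g * h)⁻¹) = fun x => g * (h * x * h⁻¹) * g⁻¹ := by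
    ext x; group
  rw [modelAd_eq, e, modelDeriv_comp (g := fun x => g * x * g⁻¹) (y := 1) (by simp)
    ((contMDiff_conj g).mdifferentiable (by simp) _)
    ((contMDiff_conj h).mdifferentiable (by simp) _), modelAd_eq, modelAd_eq]

theorem modelDeriv_comp_modelAd (θ : G ≃* G) (hθ : ContMDiff 𝓘(ℝ, E) 𝓘(ℝ, E) ∞ θ) (g : G) :
    (modelDeriv E E θ 1).comp (modelAd E g) = (modelAd E (θ g)).comp (modelDeriv E E θ 1) := by
  rw [modelAd_eq, modelAd_eq, ← modelDeriv_comp (g := θ) (by simp)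
    (hθ.mdifferentiable (by simp) _) ((contMDiff_conj g).mdifferentiable (by simp) _),
    ← modelDeriv_comp (g := fun h => θ g * h * (θ g)⁻¹) (map_one θ)
    ((contMDiff_conj _).mdifferentiable (by simp) _) (hθ.mdifferentiable (by simp) _)]
  simp

/-- Conjugation by `z` and the identity are homomorphisms with the same differential, and `G` is
connected. -/
theorem commute_of_modelAd_eq_id [PreconnectedSpace G] {z : G}
    (h : modelAd E z = ContinuousLinearMap.id ℝ E) (g : G) : z * g = g * z := by
  have := MonoidHom.eq_of_modelDeriv_eq (E := E) (φ := (MulAut.conj z).toMonoidHom)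
    (ψ := MonoidHom.id G) ((contMDiff_conj z).mdifferentiable (by simp)) mdifferentiable_id
    (by
      have h2 : modelDeriv E E (MonoidHom.id G) 1 = ContinuousLinearMap.id ℝ E := modelDeriv_id _
      rw [h2, ← h]
      rfl) g
  have h3 : z * g * z⁻¹ = g := this
  rwa [mul_inv_eq_iff_eq_mul] at h3

/-- Partial derivatives of the jointly smooth map `(g, h) ↦ g h g⁻¹` depend continuously on `g`.
They are expressed in tangent coordinates, but source and target points are always `1`, so the
coordinate changes are the identity. -/
theorem continuous_modelAd : Continuous (modelAd E : G → E →L[ℝ] E) := by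
  have : IsManifold 𝓘(ℝ, E) 1 G := IsManifold.of_le (n := ∞) (by exact_mod_cast le_top)
  rw [continuous_iff_continuousAt]
  intro x
  have hf : ContMDiffAt (𝓘(ℝ, E).prod 𝓘(ℝ, E)) 𝓘(ℝ, E) ∞
      (Function.uncurry fun g h : G => g * h * g⁻¹) (x, (1 : G)) :=
    (((contMDiff_mul 𝓘(ℝ, E) ∞).comp ((contMDiff_mul 𝓘(ℝ, E) ∞).comp
      (contMDiff_fst.prodMk contMDiff_snd) |>.prodMk
        ((contMDiff_inv 𝓘(ℝ, E) ∞).comp contMDiff_fst)))).contMDiffAt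
  have h := (ContMDiffAt.mfderiv (m := 0) (fun g h : G => g * h * g⁻¹) (fun _ => 1) hf
    contMDiffAt_const (by simp)).continuousAt
  refine h.congr (Filter.Eventually.of_forall fun g => ?_)
  refine (inTangentCoordinates_eq (I := 𝓘(ℝ, E)) (I' := 𝓘(ℝ, E)) (fun _ : G => (1 : G))
    (fun y : G => y * 1 * y⁻¹) (fun y => modelAd E y) (x₀ := x) (x := g)
    (mem_chart_source E (1 : G)) (by simp)).trans ?_
  refine ContinuousLinearMap.ext fun v => ?_
  have h1 : ∀ (p q r : G), p = r → q = r → ∀ w : E, (tangentBundleCore 𝓘(ℝ, E) G).coordChange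
      (achart E p) (achart E q) r w = w := by
    rintro p q r rfl rfl w
    exact (tangentBundleCore 𝓘(ℝ, E) G).coordChange_self _ _ (mem_achart_source E _) w
  refine (h1 _ _ _ (by simp) (by simp) _).trans ?_
  exact congrArg (modelAd E g) (h1 _ _ _ rfl rfl v)

end OneParameterSubgroup

/-! ### Linearized Cartan decompositions: the Hilbert-Schmidt norm and properness modulo the kernel.
-/

/-- A Cartan decomposition `G = K exp 𝔭` of a topological group together with a finite-dimensional
representation `ρ` (in practice the adjoint representation) for which the Cartan involution is
`g ↦ (gᵀ)⁻¹`. -/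
structure LinearizedCartan (G : Type*) [Group G] [TopologicalSpace G] (P : Type*)
    [NormedAddCommGroup P] [NormedSpace ℝ P] (ι : Type*) [Fintype ι] [DecidableEq ι] where
  θ : G ≃* G
  ex : P → G
  ρ : G →* Matrix ι ι ℝ
  continuous_ρ : Continuous ρ
  ex_add_smul : ∀ (s t : ℝ) (a : P), ex ((s + t) • a) = ex (s • a) * ex (t • a)
  θ_ex : ∀ a, θ (ex a) = ex (-a)
  conj_ex : ∀ k, θ k = k → ∀ a, ∃ a', k * ex a * k⁻¹ = ex a'
  isCompact_fixed : IsCompact {k : G | θ k = k}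
  decomposition : IsHomeomorph fun x : {k : G // θ k = k} × P => (x.1 : G) * ex x.2
  ρ_transpose : ∀ g, (ρ g).transpose = ρ (θ g)⁻¹
  trace_θ : ∀ g, (ρ (θ g)).trace = (ρ g).trace
  commute_of_ρ_eq_one : ∀ z, ρ z = 1 → ∀ g, Commute z g
  ex_add : ∀ v, (∀ t : ℝ, ρ (ex (t • v)) = 1) → ∀ a, ex (a + v) = ex a * ex v
  ρ_ex_eq_one : ∀ a, (∀ b, Commute (ρ (ex a)) (ρ (ex b))) → ρ (ex a) = 1

namespace LinearizedCartan

variable {G : Type*} [Group G] [TopologicalSpace G] {P : Type*}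
    [NormedAddCommGroup P] [NormedSpace ℝ P] {ι : Type*} [Fintype ι] [DecidableEq ι]
    (L : LinearizedCartan G P ι)

theorem ex_zero : L.ex 0 = 1 := by
  have := L.ex_add_smul 0 0 0
  simp only [smul_zero] at this
  exact left_eq_mul.mp this

theorem ex_neg (a : P) : L.ex (-a) = (L.ex a)⁻¹ := by
  have := L.ex_add_smul (-1) 1 a
  rw [neg_add_cancel, zero_smul, ex_zero, neg_smul, one_smul] at this
  exact eq_inv_of_mul_eq_one_left this.symm

theorem ex_natCast_smul (n : ℕ) (a : P) : L.ex ((n : ℝ) • a) = L.ex a ^ n := by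
  induction n with
  | zero => simp [ex_zero]
  | succ n ih => rw [Nat.cast_succ, ex_add_smul, ih, one_smul, pow_succ]

theorem ex_half_mul_self (a : P) : L.ex ((1 / 2 : ℝ) • a) * L.ex ((1 / 2 : ℝ) • a) = L.ex a := by
  rw [← ex_add_smul]
  norm_num

theorem ex_mul_self (a : P) : L.ex a * L.ex a = L.ex ((2 : ℝ) • a) := by
  have := L.ex_natCast_smul 2 a
  rw [pow_two] at this
  exact_mod_cast this.symm

theorem continuous_ex : Continuous L.ex := by
  have := L.decomposition.continuous.comp
    (Continuous.prodMk_right (⟨1, map_one L.θ⟩ : {k : G // L.θ k = k}))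
  simpa [Function.comp_def] using this

theorem exists_eq_mul_ex (g : G) : ∃ k a, L.θ k = k ∧ g = k * L.ex a := by
  obtain ⟨⟨⟨k, hk⟩, a⟩, h⟩ := L.decomposition.surjective g
  exact ⟨k, a, hk, h.symm⟩

theorem eq_and_eq_of_mul_ex_eq {k k' : G} {a a' : P} (hk : L.θ k = k) (hk' : L.θ k' = k')
    (h : k * L.ex a = k' * L.ex a') : k = k' ∧ a = a' := by
  have := L.decomposition.injective (a₁ := (⟨k, hk⟩, a)) (a₂ := (⟨k', hk'⟩, a')) h
  simpa using this

theorem ρ_ex_transpose (a : P) : (L.ρ (L.ex a)).transpose = L.ρ (L.ex a) := by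
  rw [ρ_transpose, θ_ex, ex_neg, inv_inv]

theorem ρ_inv_mul (g : G) : L.ρ g⁻¹ * L.ρ g = 1 := by
  rw [← map_mul, inv_mul_cancel, map_one]

theorem ρ_fixed {k : G} (hk : L.θ k = k) : (L.ρ k).transpose * L.ρ k = 1 := by
  rw [ρ_transpose, hk, ρ_inv_mul]

theorem posDef_ρ_ex (a : P) : (L.ρ (L.ex a)).PosDef := by
  have h := Matrix.PosDef.conjTranspose_mul_self (L.ρ (L.ex ((1 / 2 : ℝ) • a))) (by
    intro v w hvw
    have := congrArg (L.ρ (L.ex ((1 / 2 : ℝ) • a))⁻¹).mulVec hvw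
    simpa [Matrix.mulVec_mulVec, ρ_inv_mul] using this)
  rwa [Matrix.conjTranspose_eq_transpose_of_trivial, ρ_ex_transpose, ← map_mul,
    ex_half_mul_self] at h

theorem trace_ρ_ex_neg (a : P) : (L.ρ (L.ex (-a))).trace = (L.ρ (L.ex a)).trace := by
  rw [← θ_ex, trace_θ]

/-- The squared Hilbert-Schmidt norm of `ρ g`. -/
noncomputable def normSq (g : G) : ℝ := ((L.ρ g).transpose * L.ρ g).trace

theorem continuous_normSq : Continuous L.normSq :=
  ((L.continuous_ρ.matrix_transpose).matrix_mul L.continuous_ρ).matrix_trace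

theorem normSq_eq_sum (g : G) : L.normSq g = ∑ j, ∑ i, L.ρ g i j ^ 2 := by
  simp [normSq, Matrix.trace, Matrix.mul_apply, pow_two]

theorem normSq_nonneg (g : G) : 0 ≤ L.normSq g := by
  rw [normSq_eq_sum]
  positivity

theorem abs_ρ_le (g : G) (i j : ι) : |L.ρ g i j| ≤ 1 + L.normSq g := by
  have h1 : L.ρ g i j ^ 2 ≤ L.normSq g := by
    rw [normSq_eq_sum]
    calc L.ρ g i j ^ 2 ≤ ∑ i, L.ρ g i j ^ 2 :=
          Finset.single_le_sum (f := fun i => L.ρ g i j ^ 2) (fun _ _ => sq_nonneg _)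
            (Finset.mem_univ i)
      _ ≤ _ := Finset.single_le_sum (f := fun j => ∑ i, L.ρ g i j ^ 2)
            (fun _ _ => by positivity) (Finset.mem_univ j)
  rw [← sq_abs] at h1
  nlinarith [sq_nonneg (|L.ρ g i j| - 1)]

theorem normSq_mul_of_orthogonal {w : G} (hw : (L.ρ w).transpose * L.ρ w = 1) (g : G) :
    L.normSq (g * w) = L.normSq g := by
  have hw' : L.ρ w * (L.ρ w).transpose = 1 := mul_eq_one_comm.mp hw
  rw [normSq, map_mul, Matrix.transpose_mul, Matrix.trace_mul_comm, normSq]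
  have : L.ρ g * L.ρ w * ((L.ρ w).transpose * (L.ρ g).transpose) = L.ρ g * (L.ρ g).transpose := by
    calc _ = L.ρ g * (L.ρ w * (L.ρ w).transpose) * (L.ρ g).transpose := by noncomm_ring
      _ = _ := by rw [hw', mul_one]
  rw [this, Matrix.trace_mul_comm]

theorem normSq_fixed_mul {k : G} (hk : L.θ k = k) (g : G) :
    L.normSq (k * g) = L.normSq g := by
  rw [normSq, map_mul, Matrix.transpose_mul, normSq]
  have : (L.ρ g).transpose * (L.ρ k).transpose * (L.ρ k * L.ρ g)
      = (L.ρ g).transpose * ((L.ρ k).transpose * L.ρ k) * L.ρ g := by noncomm_ring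
  rw [this, L.ρ_fixed hk, mul_one]

theorem normSq_ex (a : P) : L.normSq (L.ex a) = (L.ρ (L.ex ((2 : ℝ) • a))).trace := by
  rw [normSq, ρ_ex_transpose, ← map_mul, ex_mul_self]

/-- For `r = i / j` this compares the `i`-th and `j`-th powers of `ρ (ex (a / j))`; a general `r` is
the limit of `⌊r j⌋ / j`. -/
theorem trace_ρ_ex_smul_le (a : P) {r : ℝ} (hr0 : 0 ≤ r) (hr1 : r ≤ 1) :
    (L.ρ (L.ex (r • a))).trace ≤ Fintype.card ι + (L.ρ (L.ex a)).trace := by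
  have hcont : Continuous fun r : ℝ => (L.ρ (L.ex (r • a))).trace :=
    (L.continuous_ρ.comp (L.continuous_ex.comp (continuous_id.smul continuous_const))).matrix_trace
  have hlim := (hcont.tendsto r).comp ((tendsto_nat_floor_mul_div_atTop hr0).comp
    (tendsto_natCast_atTop_atTop (R := ℝ)))
  refine le_of_tendsto hlim ?_
  filter_upwards [Filter.eventually_gt_atTop 0] with j hj
  have hj' : (j : ℝ) ≠ 0 := by positivity
  simp only [Function.comp_apply]
  set i := ⌊r * (j : ℝ)⌋₊
  have hij : i ≤ j := by
    refine Nat.floor_le_of_le ?_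
    nlinarith [(Nat.cast_nonneg j : (0 : ℝ) ≤ j)]
  have h := (L.posDef_ρ_ex ((j : ℝ)⁻¹ • a)).trace_pow_le hij
  rw [← map_pow, ← map_pow, ← ex_natCast_smul, ← ex_natCast_smul, smul_smul, smul_smul,
    mul_inv_cancel₀ hj', one_smul, ← div_eq_mul_inv] at h
  exact h

/-- The directions in `P` whose one-parameter subgroups act trivially. -/
def kernelDirections : Submodule ℝ P where
  carrier := {v | ∀ t : ℝ, L.ρ (L.ex (t • v)) = 1}
  -- Additivity rests on `ex_add`: directions acting trivially exponentiate to central elements.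
  add_mem' := by
    intro a b ha hb t
    rw [smul_add, L.ex_add (t • b) (fun s => by rw [smul_smul]; exact hb _), map_mul, ha, hb,
      mul_one]
  zero_mem' := by
    intro t
    rw [smul_zero, ex_zero, map_one]
  smul_mem' := by
    intro c v hv t
    rw [smul_smul]
    exact hv _

variable [FiniteDimensional ℝ P]

/-- Otherwise a sequence in `W` with bounded traces goes to infinity, and its directions accumulate
at a unit vector `u ∈ W`. The trace is then bounded along the ray of `u`, hence on all powers of `ρ
(ex (s • u))` and of its inverse. So `u` is a kernel direction, contradicting disjointness. -/
theorem exists_norm_le_of_trace_le {W : Submodule ℝ P} (hW : Disjoint L.kernelDirections W)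
    (R : ℝ) : ∃ r, ∀ a ∈ W, (L.ρ (L.ex a)).trace ≤ R → ‖a‖ ≤ r := by
  by_contra! hcon
  choose a haW haR han using fun n : ℕ => hcon n
  have hpos : ∀ n, 0 < ‖a n‖ := fun n => (Nat.cast_nonneg n).trans_lt (han n)
  have hsph : ∀ n, ‖a n‖⁻¹ • a n ∈ Metric.sphere (0 : P) 1 := fun n => by
    rw [mem_sphere_zero_iff_norm, norm_smul, norm_inv, norm_norm, inv_mul_cancel₀ (hpos n).ne']
  have : ProperSpace P := FiniteDimensional.proper ℝ P
  obtain ⟨u, hu, φ, hφ, hlim⟩ := (isCompact_sphere (0 : P) 1).tendsto_subseq hsph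
  have huW : u ∈ W := (Submodule.closed_of_finiteDimensional W).mem_of_tendsto hlim
    (Filter.Eventually.of_forall fun n => W.smul_mem _ (haW _))
  have hbound : ∀ s : ℝ, 0 ≤ s → (L.ρ (L.ex (s • u))).trace ≤ Fintype.card ι + R := by
    intro s hs
    have hcont : Continuous fun x : P => (L.ρ (L.ex (s • x))).trace :=
      (L.continuous_ρ.comp (L.continuous_ex.comp (continuous_const_smul s))).matrix_trace
    refine le_of_tendsto ((hcont.tendsto u).comp hlim) ?_
    obtain ⟨m, hm⟩ := exists_nat_ge s
    filter_upwards [Filter.eventually_ge_atTop m] with n hn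
    have h1 : s ≤ ‖a (φ n)‖ := by
      have h2 : (m : ℝ) ≤ φ n := by exact_mod_cast hn.trans (hφ.id_le n)
      linarith [han (φ n)]
    have h3 := L.trace_ρ_ex_smul_le (a (φ n)) (r := s * ‖a (φ n)‖⁻¹)
      (mul_nonneg hs (by positivity)) (by
        rw [← div_eq_mul_inv]; exact div_le_one_of_le₀ h1 (norm_nonneg _))
    simp only [Function.comp_apply, smul_smul]
    linarith [haR (φ n)]
  have hpow : ∀ s : ℝ, 0 ≤ s → L.ρ (L.ex (s • u)) = 1 := by
    intro s hs
    have hk : ∀ k : ℕ, (L.ρ (L.ex (s • u)) ^ k).trace ≤ Fintype.card ι + R := fun k => by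
      rw [← map_pow, ← ex_natCast_smul, smul_smul]
      exact hbound _ (by positivity)
    refine (L.posDef_ρ_ex (s • u)).eq_one_of_trace_pow_le (L.posDef_ρ_ex (-(s • u)))
      (by rw [ex_neg, ρ_inv_mul]) hk (fun k => ?_)
    rw [← map_pow, ← ex_natCast_smul, smul_neg, trace_ρ_ex_neg, ex_natCast_smul, map_pow]
    exact hk k
  have huV : u ∈ L.kernelDirections := by
    intro t
    rcases le_total 0 t with ht | ht
    · exact hpow t ht
    · have h := hpow (-t) (by linarith)
      have h2 := L.ρ_inv_mul (L.ex (t • u))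
      rw [← ex_neg, ← neg_smul, h, one_mul] at h2
      exact h2
  have hu0 : u = 0 := by
    have := hW.le_bot (⟨huV, huW⟩ : u ∈ L.kernelDirections ⊓ W)
    simpa using this
  rw [hu0] at hu
  simp at hu

/-- Modulo its kernel, `ρ` is proper. -/
theorem exists_compact_of_normSq_le (R : ℝ) : ∃ Q : Set G, IsCompact Q ∧
    ∀ g, L.normSq g ≤ R → ∃ z, L.ρ z = 1 ∧ g * z ∈ Q := by
  obtain ⟨W, hW⟩ := Submodule.exists_isCompl L.kernelDirections
  obtain ⟨r, hr⟩ := L.exists_norm_le_of_trace_le hW.disjoint R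
  have : ProperSpace P := FiniteDimensional.proper ℝ P
  have : CompactSpace {k : G // L.θ k = k} := isCompact_iff_compactSpace.mp L.isCompact_fixed
  refine ⟨_, (isCompact_univ.prod (isCompact_closedBall (0 : P) r)).image
    L.decomposition.continuous, fun g hg => ?_⟩
  obtain ⟨k, a, hk, rfl⟩ := L.exists_eq_mul_ex g
  obtain ⟨v, hv, w, hw, rfl⟩ : ∃ v ∈ L.kernelDirections, ∃ w ∈ W, v + w = a := by
    have : a ∈ L.kernelDirections ⊔ W := by rw [hW.sup_eq_top]; trivial
    exact Submodule.mem_sup.mp this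
  have hv1 : L.ρ (L.ex v) = 1 := by simpa using hv 1
  -- The component `v` in the kernel directions is cancelled by `z`; the complementary component `w`
  -- is bounded by the norm.
  refine ⟨L.ex (-v), by simpa using hv (-1), (⟨k, hk⟩, w), ⟨trivial, ?_⟩, ?_⟩
  · have h2 : (L.ρ (L.ex ((2 : ℝ) • w))).trace ≤ R := by
      rw [← normSq_ex]
      rw [L.normSq_fixed_mul hk, add_comm, L.ex_add v hv,
        L.normSq_mul_of_orthogonal (by rw [hv1]; simp)] at hg
      exact hg
    have h3 := hr _ (W.smul_mem 2 hw) h2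
    rw [norm_smul] at h3
    rw [mem_closedBall_zero_iff]
    norm_num at h3
    linarith [norm_nonneg w]
  · simp only
    rw [add_comm, L.ex_add v hv, ex_neg]
    group

omit [FiniteDimensional ℝ P] in
/-- An element with bounded conjugacy class acts by an orthogonal matrix. -/
theorem orthogonal_of_bounded_conj {w : G} {R : ℝ} (h : ∀ x, L.normSq (x * w * x⁻¹) ≤ R) :
    (L.ρ w).transpose * L.ρ w = 1 := by
  have hc : ∀ b, L.ρ (L.ex b) * L.ρ w = L.ρ w * L.ρ (L.ex b) := by
    intro b
    refine (L.posDef_ρ_ex b).commute_of_bounded_conj (L.ρ_inv_mul (L.ex b)) (R := 1 + R) ?_ ?_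
    · intro n i j
      have := L.abs_ρ_le (L.ex b ^ n * w * (L.ex b ^ n)⁻¹) i j
      rw [map_mul, map_mul, ← inv_pow, map_pow, map_pow] at this
      have h2 := h (L.ex b ^ n)
      rw [← inv_pow] at h2
      linarith
    · intro n i j
      have := L.abs_ρ_le ((L.ex b)⁻¹ ^ n * w * ((L.ex b)⁻¹ ^ n)⁻¹) i j
      rw [map_mul, map_mul, ← inv_pow, inv_inv, map_pow, map_pow] at this
      have h2 := h ((L.ex b)⁻¹ ^ n)
      rw [← inv_pow, inv_inv] at h2
      linarith
  have hct : ∀ b, L.ρ (L.ex b) * (L.ρ w).transpose = (L.ρ w).transpose * L.ρ (L.ex b) := by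
    intro b
    have := congrArg Matrix.transpose (hc b)
    rw [Matrix.transpose_mul, Matrix.transpose_mul, ρ_ex_transpose] at this
    exact this.symm
  -- Since `ρ w` and its transpose commute with every `ρ (ex b)`, so does their product `ρ (ex (2 •
  -- a))`, which `ρ_ex_eq_one` makes trivial.
  obtain ⟨k, a, hk, rfl⟩ := L.exists_eq_mul_ex w
  have hprod : (L.ρ (k * L.ex a)).transpose * L.ρ (k * L.ex a) = L.ρ (L.ex ((2 : ℝ) • a)) := by
    rw [map_mul, Matrix.transpose_mul, ρ_ex_transpose, mul_assoc, ← mul_assoc _ (L.ρ k),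
      L.ρ_fixed hk, one_mul, ← map_mul, ex_mul_self]
  rw [hprod]
  refine L.ρ_ex_eq_one _ fun b => ?_
  rw [← hprod]
  exact (Commute.mul_right (hct b) (hc b)).symm

end LinearizedCartan

/-! ### Minimal elements of a conjugacy class split into commuting factors. -/

namespace LinearizedCartan

variable {G : Type*} [Group G] [TopologicalSpace G] {P : Type*}
    [NormedAddCommGroup P] [NormedSpace ℝ P] {ι : Type*} [Fintype ι] [DecidableEq ι]
    (L : LinearizedCartan G P ι)

theorem exists_norm_le_of_ex_mem {C : Set G} (hC : IsCompact C) :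
    ∃ r, ∀ a, L.ex a ∈ C → ‖a‖ ≤ r := by
  set e := L.decomposition.homeomorph
  obtain ⟨r, hr⟩ := (hC.image (continuous_snd.comp e.symm.continuous)).isBounded.exists_norm_le
  refine ⟨r, fun a ha => hr a ⟨_, ha, ?_⟩⟩
  have : e (⟨1, map_one L.θ⟩, a) = L.ex a := one_mul _
  rw [← this, Function.comp_apply, e.symm_apply_apply]

/-- A central element inverted by the Cartan involution whose powers are bounded lies in `K`. -/
theorem fixed_of_central_of_bounded {z : G} (hz : ∀ g, Commute z g) (hθ : L.θ z = z⁻¹)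
    {C : Set G} (hC : IsCompact C) (hpow : ∀ n : ℕ, z ^ n ∈ C) : L.θ z = z := by
  obtain ⟨κ, c, hκ, hzc⟩ := L.exists_eq_mul_ex z
  have hcomm : κ * L.ex c = L.ex c * κ := by
    have := (hz κ).eq
    rw [hzc, mul_assoc] at this
    exact (mul_left_cancel this).symm
  have hθz : L.θ z = κ * (L.ex c)⁻¹ := by rw [hzc, map_mul, hκ, θ_ex, ex_neg]
  have hinv : z⁻¹ = κ⁻¹ * (L.ex c)⁻¹ := by rw [hzc, hcomm, mul_inv_rev]
  have hκ2 : κ = κ⁻¹ := by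
    rw [hθz, hinv] at hθ
    exact mul_right_cancel hθ
  -- The factor `κ` has square `1`, so even powers of `z` lie in `exp 𝔭`, where boundedness forces
  -- `c = 0`.
  have hsq : z ^ 2 = L.ex c ^ 2 := by
    have h1 : κ * κ = 1 := mul_eq_one_iff_eq_inv.mpr hκ2
    rw [pow_two, pow_two, hzc]
    calc κ * L.ex c * (κ * L.ex c) = κ * (L.ex c * κ) * L.ex c := by group
      _ = κ * κ * L.ex c * L.ex c := by rw [← hcomm]; group
      _ = _ := by rw [h1, one_mul]
  obtain ⟨r, hr⟩ := L.exists_norm_le_of_ex_mem hC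
  have hbd : ∀ n : ℕ, 2 * (n : ℝ) * ‖c‖ ≤ r := by
    intro n
    have h1 := hr (((2 * n : ℕ) : ℝ) • c) (by
      rw [ex_natCast_smul, pow_mul, ← hsq, ← pow_mul]
      exact hpow _)
    rw [norm_smul] at h1
    simpa using h1
  have hc : c = 0 := by
    by_contra hc
    have hc' : 0 < ‖c‖ := norm_pos_iff.mpr hc
    obtain ⟨n, hn⟩ := exists_nat_gt (r / ‖c‖)
    rw [div_lt_iff₀ hc'] at hn
    have := hbd n
    nlinarith [mul_nonneg (Nat.cast_nonneg (α := ℝ) n) hc'.le]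
  rw [hzc, hc, ex_zero, mul_one, hκ]

variable [IsTopologicalGroup G]

/-- An element minimizing the Hilbert-Schmidt norm on its conjugacy class is the product of
commuting elements of `K` and `exp 𝔭`. -/
theorem exists_commuting_decomposition {h : G} (hmin : ∀ x, L.normSq h ≤ L.normSq (x * h * x⁻¹)) :
    ∃ k a, L.θ k = k ∧ Commute k (L.ex a) ∧ h = k * L.ex a := by
  obtain ⟨k, a, hk, rfl⟩ := L.exists_eq_mul_ex h
  refine ⟨k, a, hk, ?_, rfl⟩
  have hUS : L.ρ k * L.ρ (L.ex a) = L.ρ (L.ex a) * L.ρ k := by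
    refine Matrix.commute_of_trace_mul_self_le (L.ρ_ex_transpose a) (L.ρ_fixed hk) ?_
    -- With `H = e^{a/2}`, the conjugate of `k e^a` is `H k H`, whose norm is the trace pairing of
    -- `ρ (e^a)` with its conjugate by `ρ k`. Minimality is then the hypothesis of the trace
    -- criterion.
    have h1 := hmin (L.ex ((1 / 2 : ℝ) • a))
    set H := L.ex ((1 / 2 : ℝ) • a)
    have hH : H * H = L.ex a := L.ex_half_mul_self a
    have hHt : (L.ρ H).transpose = L.ρ H := L.ρ_ex_transpose _
    have h2 : H * (k * L.ex a) * H⁻¹ = H * k * H := by rw [← hH]; group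
    have h3 : L.normSq (H * k * H) =
        (L.ρ (L.ex a) * ((L.ρ k).transpose * L.ρ (L.ex a) * L.ρ k)).trace := by
      rw [normSq, ← hH]
      simp only [map_mul, Matrix.transpose_mul, hHt]
      rw [Matrix.trace_mul_comm (L.ρ H * L.ρ H)]
      have : L.ρ H * ((L.ρ k).transpose * L.ρ H) * (L.ρ H * L.ρ k * L.ρ H) =
        L.ρ H * ((L.ρ k).transpose * L.ρ H * L.ρ H * L.ρ k * L.ρ H) := by noncomm_ring
      rw [this, Matrix.trace_mul_comm]
      congr 1
      noncomm_ring
    have h4 : L.normSq (k * L.ex a) = (L.ρ (L.ex a) * L.ρ (L.ex a)).trace := by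
      rw [L.normSq_fixed_mul hk, normSq, ρ_ex_transpose]
    rw [h2, h3, h4] at h1
    exact h1
  set e := L.ex a
  -- The commutator obstructing the claim: it lies in the kernel of `ρ`, hence is central.
  set z := e⁻¹ * (k⁻¹ * e * k) with hz
  have hρz : L.ρ z = 1 := by
    have h5 : L.ρ z = L.ρ e⁻¹ * (L.ρ k⁻¹ * (L.ρ e * L.ρ k)) := by
      rw [hz]; simp only [map_mul]; noncomm_ring
    rw [h5, ← hUS, ← mul_assoc (L.ρ k⁻¹), ρ_inv_mul, one_mul, ρ_inv_mul]
  have hcen := L.commute_of_ρ_eq_one z hρz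
  have hconj : k⁻¹ * e * k = e * z := by rw [hz]; group
  have hθ : L.θ z = z⁻¹ := by
    have h6 : e * z⁻¹ * e⁻¹ = z⁻¹ := by
      rw [← ((hcen e).inv_left).eq, mul_assoc, mul_inv_cancel, mul_one]
    rw [← h6, hz]
    simp only [map_mul, map_inv, hk, e, θ_ex, ex_neg]
    group
  -- All powers of `z` therefore lie in the compact set `e⁻¹ K e K`, so `z ∈ K`.
  have hpow : ∀ n : ℕ, (k ^ n)⁻¹ * e * k ^ n = e * z ^ n := by
    intro n
    induction n with
    | zero => simp
    | succ n ih =>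
      calc (k ^ (n + 1))⁻¹ * e * k ^ (n + 1) = k⁻¹ * ((k ^ n)⁻¹ * e * k ^ n) * k := by
            rw [pow_succ]; group
        _ = k⁻¹ * e * (z ^ n * k) := by rw [ih]; group
        _ = k⁻¹ * e * k * z ^ n := by rw [((hcen k).pow_left n).eq]; group
        _ = e * z ^ (n + 1) := by rw [hconj, pow_succ']; group
  have hK := L.isCompact_fixed
  have hC : IsCompact ((fun p : G × G => e⁻¹ * (p.1 * e * p.2)) ''
      ({k | L.θ k = k} ×ˢ {k | L.θ k = k})) :=
    (hK.prod hK).image (by fun_prop)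
  have hfix := L.fixed_of_central_of_bounded hcen hθ hC (fun n => by
    refine ⟨((k ^ n)⁻¹, k ^ n), ⟨by simp [hk], by simp [hk]⟩, ?_⟩
    simp only
    rw [hpow]
    group)
  obtain ⟨a', ha'⟩ := L.conj_ex k⁻¹ (by rw [map_inv, hk]) a
  rw [inv_inv] at ha'
  -- Two Cartan decompositions of `k⁻¹ e k`; comparing their `K`-factors gives `z = 1`.
  have h7 : 1 * L.ex a' = z * L.ex a := by
    rw [one_mul, ← ha', (hcen _).eq]
    exact hconj
  have h8 := (L.eq_and_eq_of_mul_ex_eq (map_one _) hfix h7).1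
  rw [← h8, mul_one] at hconj
  have h9 : e * k = k * e := by
    calc e * k = k * (k⁻¹ * e * k) := by group
      _ = k * e := by rw [hconj]
  exact h9.symm

end LinearizedCartan

/-! ### Discrete cocompact subgroups: finite generation and centralizers. -/

section Lattice

variable {G : Type*} [Group G] [TopologicalSpace G] [IsTopologicalGroup G]

/-- The quotient map is open, so finitely many images of interiors of compact neighbourhoods cover
the quotient. Openness of `U` serves the connectedness argument, compactness of `C` the finiteness
arguments. -/
theorem IsCocompactSubgroup.exists_isOpen_cover [LocallyCompactSpace G] {Γ : Subgroup G}
    (h : IsCocompactSubgroup Γ) : ∃ U C : Set G, IsOpen U ∧ IsCompact C ∧ U ⊆ C ∧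
      ∀ g, ∃ δ ∈ Γ, ∃ c ∈ U, g = δ * c := by
  have : CompactSpace (Quotient (QuotientGroup.rightRel Γ)) := h
  choose N hN hN' using fun g : G => exists_compact_mem_nhds g
  let q : G → Quotient (QuotientGroup.rightRel Γ) := Quotient.mk _
  have hq : ∀ x y : G, q x = q y ↔ y * x⁻¹ ∈ Γ := fun x y =>
    Quotient.eq.trans QuotientGroup.rightRel_apply
  have hopen : ∀ g, IsOpen (q '' interior (N g)) := by
    intro g
    refine isOpen_coinduced.mpr ?_
    have : (q ⁻¹' (q '' interior (N g)) : Set G)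
        = ⋃ δ : Γ, (fun x => (δ : G) * x) ⁻¹' interior (N g) := by
      ext x
      simp only [Set.mem_preimage, Set.mem_image, Set.mem_iUnion]
      constructor
      · rintro ⟨y, hy, hxy⟩
        have h1 := (hq x y).mp hxy.symm
        exact ⟨⟨_, h1⟩, by simpa using hy⟩
      · rintro ⟨δ, hδ⟩
        refine ⟨_, hδ, ((hq x _).mpr ?_).symm⟩
        simp
    change IsOpen (q ⁻¹' _)
    rw [this]
    exact isOpen_iUnion fun δ => isOpen_interior.preimage (continuous_const_mul _)
  obtain ⟨t, ht⟩ := isCompact_univ.elim_finite_subcover (fun g => q '' interior (N g)) hopen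
    (fun p _ => by
      obtain ⟨g, rfl⟩ := Quotient.exists_rep p
      exact Set.mem_iUnion.mpr ⟨g, g, mem_interior_iff_mem_nhds.mpr (hN' g), rfl⟩)
  refine ⟨⋃ g ∈ t, interior (N g), ⋃ g ∈ t, N g, isOpen_biUnion fun _ _ => isOpen_interior,
    t.isCompact_biUnion fun g _ => hN g, Set.iUnion₂_mono fun _ _ => interior_subset, fun g => ?_⟩
  have hg := ht (Set.mem_univ (q g))
  simp only [Set.mem_iUnion] at hg
  obtain ⟨i, hi, c, hc, hcg⟩ := hg
  exact ⟨g * c⁻¹, (hq c g).mp hcg, c, Set.mem_iUnion₂.mpr ⟨i, hi, hc⟩, by group⟩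

variable [T2Space G]

theorem Subgroup.finite_inter_isCompact {Γ : Subgroup G} (hΓ : DiscreteTopology Γ) {C : Set G}
    (hC : IsCompact C) : ((Γ : Set G) ∩ C).Finite := by
  have hcl : IsClosed (Γ : Set G) := Subgroup.isClosed_of_discrete
  have hK : IsCompact ((Γ : Set G) ∩ C) := hC.inter_left hcl
  refine hK.finite ?_
  exact isDiscrete_iff_discreteTopology.mpr
    (DiscreteTopology.of_subset (s := (Γ : Set G)) hΓ Set.inter_subset_left)

/-- A discrete cocompact subgroup of a connected locally compact group is finitely generated. -/
theorem IsCocompactSubgroup.exists_finite_closure_eq [LocallyCompactSpace G] [ConnectedSpace G]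
    {Γ : Subgroup G} (hΓ : DiscreteTopology Γ) (h : IsCocompactSubgroup Γ) :
    ∃ F : Set G, F.Finite ∧ Subgroup.closure F = Γ := by
  obtain ⟨U, C, hU, hC, hUC, hcov⟩ := h.exists_isOpen_cover
  set D : Set G := (fun p : G × G => p.1 * p.2⁻¹) '' (C ×ˢ C)
  have hD : IsCompact D := (hC.prod hC).image (by fun_prop)
  refine ⟨(Γ : Set G) ∩ D, Subgroup.finite_inter_isCompact hΓ hD, le_antisymm
    ((Subgroup.closure_le Γ).mpr Set.inter_subset_left) ?_⟩
  set Γ₀ := Subgroup.closure ((Γ : Set G) ∩ D)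
  have hΓ₀ : Γ₀ ≤ Γ := (Subgroup.closure_le Γ).mpr Set.inter_subset_left
  have hstep : ∀ δ ∈ Γ, ∀ c ∈ U, ∀ δ' ∈ Γ, ∀ c' ∈ U, δ * c = δ' * c' → δ' ∈ Γ₀ → δ ∈ Γ₀ := by
    intro δ hδ c hc δ' hδ' c' hc' heq hmem
    have h1 : δ'⁻¹ * δ = c' * c⁻¹ := by
      rw [eq_mul_inv_iff_mul_eq, mul_assoc, heq]; group
    have h2 : δ'⁻¹ * δ ∈ Γ₀ := Subgroup.subset_closure
      ⟨Γ.mul_mem (Γ.inv_mem hδ') hδ, ⟨(c', c), ⟨hUC hc', hUC hc⟩, h1.symm⟩⟩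
    simpa using Γ₀.mul_mem hmem h2
  -- `A = Γ₀ U` and `B = (Γ \ Γ₀) U` are open, cover `G`, and are disjoint because overlapping
  -- translates differ by an element of `Γ ∩ C C⁻¹`. Connectedness leaves no room for `B`.
  set A : Set G := ⋃ δ : Γ₀, (fun x => (δ : G)⁻¹ * x) ⁻¹' U
  set B : Set G := ⋃ δ : {δ : G // δ ∈ Γ ∧ δ ∉ Γ₀}, (fun x => (δ : G)⁻¹ * x) ⁻¹' U
  have hA : IsOpen A := isOpen_iUnion fun δ => hU.preimage (continuous_const_mul _)
  have hB : IsOpen B := isOpen_iUnion fun δ => hU.preimage (continuous_const_mul _)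
  have hAB : A ∪ B = Set.univ := by
    refine Set.eq_univ_of_forall fun g => ?_
    obtain ⟨δ, hδ, c, hc, rfl⟩ := hcov g
    by_cases hδ₀ : δ ∈ Γ₀
    · exact Or.inl (Set.mem_iUnion.mpr ⟨⟨δ, hδ₀⟩, by simpa using hc⟩)
    · exact Or.inr (Set.mem_iUnion.mpr ⟨⟨δ, hδ, hδ₀⟩, by simpa using hc⟩)
  have hdisj : ∀ x, x ∈ A → x ∉ B := by
    intro x hxA hxB
    obtain ⟨δ', hδ'⟩ := Set.mem_iUnion.mp hxA
    obtain ⟨δ, hδ⟩ := Set.mem_iUnion.mp hxB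
    exact δ.2.2 (hstep δ δ.2.1 _ hδ δ' (hΓ₀ δ'.2) _ hδ' (by group) δ'.2)
  have hAne : A.Nonempty := by
    obtain ⟨δ, hδ, c, hc, -⟩ := hcov 1
    exact ⟨c, Set.mem_iUnion.mpr ⟨1, by simpa using hc⟩⟩
  have hclopen : IsClopen A := by
    refine ⟨?_, hA⟩
    have : A = Bᶜ := Set.Subset.antisymm (fun x hx => hdisj x hx) fun x hx =>
      (hAB ▸ Set.mem_univ x : x ∈ A ∪ B).resolve_right hx
    rw [this]
    exact hB.isClosed_compl
  have hAu : A = Set.univ := hclopen.eq_univ hAne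
  intro δ hδ
  obtain ⟨ε, hε, c, hc, -⟩ := hcov 1
  by_contra hδ₀
  have hxB : δ * c ∈ B := Set.mem_iUnion.mpr ⟨⟨δ, hδ, hδ₀⟩, by simpa using hc⟩
  exact hdisj _ (hAu ▸ Set.mem_univ _) hxB

theorem Subgroup.eventually_eq_of_tendsto {Γ : Subgroup G} (hΓ : DiscreteTopology Γ) {α : Type*}
    {l : Filter α} [l.NeBot] {f : α → G} (hf : ∀ n, f n ∈ Γ) {x : G}
    (hx : Filter.Tendsto f l (nhds x)) : ∀ᶠ n in l, f n = x := by
  have hcl : IsClosed (Γ : Set G) := Subgroup.isClosed_of_discrete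
  have hxΓ : x ∈ Γ := hcl.mem_of_tendsto hx (Filter.Eventually.of_forall hf)
  have h1 : Filter.Tendsto (fun n => (⟨f n, hf n⟩ : Γ)) l (nhds ⟨x, hxΓ⟩) :=
    tendsto_subtype_rng.mpr hx
  rw [nhds_discrete, Filter.tendsto_pure] at h1
  exact h1.mono fun n hn => congrArg Subtype.val hn

/-- If `Γ` is discrete and cocompact in `G` then, for `γ ∈ Γ`, `Γ ∩ Z(γ)` is cocompact in
`Z(γ)`. -/
theorem IsCocompactSubgroup.centralizer [LocallyCompactSpace G] {Γ : Subgroup G}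
    (hΓ : DiscreteTopology Γ) (h : IsCocompactSubgroup Γ) {γ : G} (hγ : γ ∈ Γ) :
    IsCocompactSubgroup (Γ.subgroupOf (Subgroup.centralizer {γ})) := by
  obtain ⟨U, C, -, hC, hUC, hcov⟩ := h.exists_isOpen_cover
  set Z := Subgroup.centralizer ({γ} : Set G)
  have hfin : ((Γ : Set G) ∩ ((fun c => c * γ * c⁻¹) '' C)).Finite :=
    Subgroup.finite_inter_isCompact hΓ (hC.image (by fun_prop))
  -- If `z = δ c` centralizes `γ`, then `η = c γ c⁻¹ = δ⁻¹ γ δ` lies in the finite set of `hfin`. A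
  -- fixed conjugator `d η ∈ Γ` of `η` to `γ` puts `d η * c` in `Z`, in the same coset as `z`. The
  -- value `1` is only a filler for other `η`.
  have hδ : ∀ η : G, ∃ δ ∈ Γ, (∃ ε ∈ Γ, ε * η * ε⁻¹ = γ) → δ * η * δ⁻¹ = γ := by
    intro η
    by_cases hη : ∃ ε ∈ Γ, ε * η * ε⁻¹ = γ
    · obtain ⟨ε, hε, he⟩ := hη
      exact ⟨ε, hε, fun _ => he⟩
    · exact ⟨1, Γ.one_mem, fun h' => absurd h' hη⟩
  choose d hdΓ hd using hδ
  have hZcl : IsClosed (Z : Set G) := Set.isClosed_centralizer {γ}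
  set D : Set Z := ⋃ η ∈ (Γ : Set G) ∩ ((fun c => c * γ * c⁻¹) '' C),
    Subtype.val ⁻¹' ((fun c => d η * c) '' C)
  have hD : IsCompact D := hfin.isCompact_biUnion fun η _ =>
    hZcl.isClosedEmbedding_subtypeVal.isCompact_preimage (hC.image (by fun_prop))
  let q : Z → Quotient (QuotientGroup.rightRel (Γ.subgroupOf Z)) := Quotient.mk _
  have hq : Continuous q := continuous_quotient_mk'
  have himage : q '' D = Set.univ := by
    refine Set.eq_univ_of_forall fun p => ?_
    obtain ⟨⟨z, hz⟩, rfl⟩ := Quotient.exists_rep p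
    obtain ⟨δ, hδΓ, c, hcU, hzc⟩ := hcov z
    have hzγ : z * γ * z⁻¹ = γ :=
      mul_inv_eq_iff_eq_mul.mpr (Subgroup.mem_centralizer_singleton_iff.mp hz)
    set η := c * γ * c⁻¹ with hη
    have hη1 : δ * η * δ⁻¹ = γ := by
      rw [← hzγ, hη, hzc]; group
    have hη2 : η = δ⁻¹ * γ * δ := by rw [← hη1]; group
    have hηΓ : η ∈ Γ := by
      rw [hη2]; exact Γ.mul_mem (Γ.mul_mem (Γ.inv_mem hδΓ) hγ) hδΓ
    have hdη := hd η ⟨δ, hδΓ, hη1⟩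
    have hmem : d η * c ∈ Z := by
      rw [Subgroup.mem_centralizer_singleton_iff]
      calc d η * c * γ = d η * (c * γ * c⁻¹) * (d η)⁻¹ * (d η * c) := by group
        _ = γ * (d η * c) := by rw [← hη, hdη]
    refine ⟨⟨d η * c, hmem⟩, Set.mem_iUnion₂.mpr ⟨η, ⟨hηΓ, c, hUC hcU, rfl⟩, c, hUC hcU, rfl⟩, ?_⟩
    refine Quotient.sound (QuotientGroup.rightRel_apply.mpr ?_)
    rw [Subgroup.mem_subgroupOf]
    have : z * (d η * c)⁻¹ = δ * (d η)⁻¹ := by rw [hzc]; group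
    simp only [Subgroup.coe_mul, Subgroup.coe_inv, this]
    exact Γ.mul_mem hδΓ (Γ.inv_mem (hdΓ η))
  exact ⟨himage ▸ hD.image hq⟩

end Lattice

/-! ### The minimum of the norm on the conjugacy class of a lattice element. -/

namespace LinearizedCartan

variable {G : Type*} [Group G] [TopologicalSpace G] [IsTopologicalGroup G] [T2Space G]
    [LocallyCompactSpace G] [ConnectedSpace G] {P : Type*}
    [NormedAddCommGroup P] [NormedSpace ℝ P] [FiniteDimensional ℝ P]
    {ι : Type*} [Fintype ι] [DecidableEq ι]
    (L : LinearizedCartan G P ι)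

/-- The Hilbert-Schmidt norm attains its minimum on the conjugacy class of an element of a
discrete cocompact subgroup. -/
theorem exists_forall_normSq_le {Γ : Subgroup G} (hΓ : DiscreteTopology Γ)
    (h : IsCocompactSubgroup Γ) {γ : G} (hγ : γ ∈ Γ) :
    ∃ x₀, ∀ x, L.normSq (x₀⁻¹ * γ * x₀) ≤ L.normSq (x⁻¹ * γ * x) := by
  obtain ⟨U, C, -, hC, hUC, hcov⟩ := h.exists_isOpen_cover
  obtain ⟨F, hF, hFΓ⟩ := h.exists_finite_closure_eq hΓ
  have hbdd : BddBelow (Set.range fun x => L.normSq (x⁻¹ * γ * x)) :=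
    ⟨0, by rintro _ ⟨x, rfl⟩; exact L.normSq_nonneg _⟩
  set m := sInf (Set.range fun x => L.normSq (x⁻¹ * γ * x)) with hm
  have hmle : ∀ x, m ≤ L.normSq (x⁻¹ * γ * x) := fun x => csInf_le hbdd ⟨x, rfl⟩
  obtain ⟨s, -, hslim, hs⟩ := exists_seq_tendsto_sInf (Set.range_nonempty _) hbdd
  choose x hx using hs
  choose δ hδ c hc hxc using fun n => hcov (x n)
  simp only at hx
  obtain ⟨Q, hQ, hQz⟩ := L.exists_compact_of_normSq_le (m + 1)
  choose! z hzρ hzQ using hQz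
  set H : ℕ → G := fun n => (x n)⁻¹ * γ * x n with hH
  -- Along a nonprincipal ultrafilter all the relatively compact sequences converge at once, without
  -- passing to subsequences.
  set 𝒰 : Ultrafilter ℕ := Filter.hyperfilter ℕ
  have h𝒰 : (𝒰 : Filter ℕ) ≤ Filter.atTop := Nat.hyperfilter_le_atTop
  have hlim : Filter.Tendsto (fun n => L.normSq (H n)) 𝒰 (nhds m) := by
    simp only [hH, hx]
    exact hslim.mono_left h𝒰
  have hev : ∀ᶠ n in (𝒰 : Filter ℕ), L.normSq (H n) ≤ m + 1 :=
    (hlim.eventually_lt_const (lt_add_one m)).mono fun _ => le_of_lt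
  obtain ⟨c₀, -, hc₀⟩ := hC.ultrafilter_le_nhds (𝒰.map c)
    (Filter.tendsto_principal (f := c).mpr (Filter.Eventually.of_forall fun n => hUC (hc n)))
  obtain ⟨q, -, hq⟩ := hQ.ultrafilter_le_nhds (𝒰.map fun n => H n * z (H n))
    (Filter.le_principal_iff.mpr (hev.mono fun n hn => hzQ _ hn))
  have hc₀' : Filter.Tendsto c 𝒰 (nhds c₀) := hc₀
  have hq' : Filter.Tendsto (fun n => H n * z (H n)) 𝒰 (nhds q) := hq
  have hcentral : ∀ n, L.normSq (H n) ≤ m + 1 → ∀ g, Commute (z (H n)) g := fun n hn =>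
    L.commute_of_ρ_eq_one _ (hzρ _ hn)
  have hmul1 : ∀ n, L.normSq (H n) ≤ m + 1 → ∀ g, L.normSq (g * z (H n)) = L.normSq g :=
    fun n hn g => L.normSq_mul_of_orthogonal (by rw [hzρ _ hn]; simp) g
  have hqm : L.normSq q = m := by
    refine tendsto_nhds_unique ((L.continuous_normSq.tendsto q).comp hq') (hlim.congr' ?_)
    filter_upwards [hev] with n hn
    exact (hmul1 n hn _).symm
  set y : ℕ → G := fun n => c n * (H n * z (H n)) * (c n)⁻¹ with hy
  set y₀ := c₀ * q * c₀⁻¹ with hy₀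
  have hylim : Filter.Tendsto y 𝒰 (nhds y₀) := (hc₀'.mul hq').mul hc₀'.inv
  have hyγ : ∀ n, L.normSq (H n) ≤ m + 1 → y n = (δ n)⁻¹ * γ * δ n * z (H n) := by
    intro n hn
    calc y n = c n * (H n * (z (H n) * (c n)⁻¹)) := by rw [hy]; group
      _ = c n * H n * (c n)⁻¹ * z (H n) := by rw [(hcentral n hn _).eq]; group
      _ = _ := by
        congr 1
        rw [hH]
        simp only [hxc n]
        group
  -- `y n` need not lie in `Γ`, but it conjugates `η` as `(δ n)⁻¹ γ δ n ∈ Γ` does; a convergent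
  -- family in a discrete subgroup is eventually constant.
  have hcomm : ∀ η ∈ Γ, ∀ᶠ n in (𝒰 : Filter ℕ), y n * η * (y n)⁻¹ = y₀ * η * y₀⁻¹ := by
    intro η hη
    have h1 : Filter.Tendsto (fun n => y n * η * (y n)⁻¹) 𝒰 (nhds (y₀ * η * y₀⁻¹)) :=
      (hylim.mul_const η).mul hylim.inv
    have h2 : ∀ᶠ n in (𝒰 : Filter ℕ), y n * η * (y n)⁻¹
        = (δ n)⁻¹ * γ * δ n * η * ((δ n)⁻¹ * γ * δ n)⁻¹ := by
      filter_upwards [hev] with n hn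
      rw [hyγ n hn]
      calc _ = (δ n)⁻¹ * γ * δ n * (z (H n) * η) * (z (H n))⁻¹ * ((δ n)⁻¹ * γ * δ n)⁻¹ := by group
        _ = _ := by rw [(hcentral n hn η).eq]; group
    have h3 := Subgroup.eventually_eq_of_tendsto hΓ (l := (𝒰 : Filter ℕ))
      (f := fun n => (δ n)⁻¹ * γ * δ n * η * ((δ n)⁻¹ * γ * δ n)⁻¹) (fun n => by
        have : (δ n)⁻¹ * γ * δ n ∈ Γ := Γ.mul_mem (Γ.mul_mem (Γ.inv_mem (hδ n)) hγ) (hδ n)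
        exact Γ.mul_mem (Γ.mul_mem this hη) (Γ.inv_mem this)) (h1.congr' h2)
    filter_upwards [h2, h3] with n hn hn'
    rw [hn, hn']
  have hcommF : ∀ᶠ n in (𝒰 : Filter ℕ), ∀ η ∈ F, y n * η * (y n)⁻¹ = y₀ * η * y₀⁻¹ :=
    (Filter.eventually_all_finite hF).mpr fun η hη =>
      hcomm η (hFΓ ▸ Subgroup.subset_closure hη)
  obtain ⟨n, hn, hnF⟩ := (hev.and hcommF).exists
  set w := (y n)⁻¹ * y₀ with hw
  have hwΓ : ∀ η ∈ Γ, Commute w η := by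
    have hle : Γ ≤ Subgroup.centralizer {w} := by
      rw [← hFΓ, Subgroup.closure_le]
      intro η hη
      rw [SetLike.mem_coe, Subgroup.mem_centralizer_singleton_iff]
      have h1 := hnF η hη
      calc η * w = (y n)⁻¹ * (y n * η * (y n)⁻¹) * y₀ := by rw [hw]; group
        _ = w * η := by rw [h1, hw]; group
    intro η hη
    exact (Subgroup.mem_centralizer_singleton_iff.mp (hle hη)).symm
  -- As `w` commutes with `Γ`, its conjugates are already obtained from the compact set `C`.
  have hbound : ∃ R, ∀ g, L.normSq (g * w * g⁻¹) ≤ R := by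
    have hcont : Continuous fun g => L.normSq (g⁻¹ * w * g) :=
      L.continuous_normSq.comp (by fun_prop)
    obtain ⟨R, hR⟩ := (hC.image hcont).bddAbove
    refine ⟨R, fun g => ?_⟩
    obtain ⟨ε, hε, b, hb, hgb⟩ := hcov g⁻¹
    have : g * w * g⁻¹ = b⁻¹ * w * b := by
      have hg : g = (ε * b)⁻¹ := by rw [← hgb, inv_inv]
      rw [hg]
      calc _ = b⁻¹ * ε⁻¹ * (w * ε) * b := by group
        _ = _ := by rw [(hwΓ ε hε).eq]; group
    rw [this]
    exact hR ⟨b, hUC hb, rfl⟩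
  obtain ⟨R, hR⟩ := hbound
  have horth := L.orthogonal_of_bounded_conj (w := c₀⁻¹ * w * c₀) (R := R) (fun g => by
    have := hR (g * c₀⁻¹)
    convert this using 2
    group)
  -- Up to the central `z (H n)` and the orthogonally acting `c₀⁻¹ w c₀`, this conjugate of `γ` is
  -- the limit `q`, of norm `m`.
  refine ⟨δ n * c₀, fun x => le_trans (le_of_eq ?_) (hmle x)⟩
  have e1 : (δ n * c₀)⁻¹ * γ * (δ n * c₀) * z (H n) = c₀⁻¹ * y n * c₀ := by
    rw [hyγ n hn]
    calc _ = c₀⁻¹ * ((δ n)⁻¹ * γ * δ n) * (c₀ * z (H n)) := by group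
      _ = _ := by rw [← (hcentral n hn c₀).eq]; group
  rw [← hmul1 n hn, e1, ← L.normSq_mul_of_orthogonal horth, ← hqm]
  congr 1
  rw [hw, hy₀]
  group

theorem exists_conj_commuting_decomposition {Γ : Subgroup G} (hΓ : DiscreteTopology Γ)
    (h : IsCocompactSubgroup Γ) {γ : G} (hγ : γ ∈ Γ) :
    ∃ g k a, L.θ k = k ∧ Commute k (L.ex a) ∧ γ = g * (k * L.ex a) * g⁻¹ := by
  obtain ⟨x₀, hx₀⟩ := L.exists_forall_normSq_le hΓ h hγ
  obtain ⟨k, a, hk, hka, hd⟩ := L.exists_commuting_decomposition (h := x₀⁻¹ * γ * x₀) (fun x => by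
    have := hx₀ (x₀ * x⁻¹)
    convert this using 2
    group)
  exact ⟨x₀, k, a, hk, hka, by rw [← hd]; group⟩

end LinearizedCartan

theorem LinearMap.BilinForm.exists_orthonormal_basis {E : Type*} [AddCommGroup E] [Module ℝ E]
    [FiniteDimensional ℝ E] {ip : LinearMap.BilinForm ℝ E} (hsymm : ∀ u v, ip u v = ip v u)
    (hpos : ∀ u, u ≠ 0 → 0 < ip u u) :
    ∃ b : Module.Basis (Fin (Module.finrank ℝ E)) ℝ E,
      ∀ i x, b.repr x i = ip (b i) x := by
  obtain ⟨v, hv⟩ := LinearMap.BilinForm.exists_orthogonal_basis (B := ip) ⟨fun u w => by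
    simpa using hsymm u w⟩
  have hvpos : ∀ i, 0 < ip (v i) (v i) := fun i => hpos _ (v.ne_zero i)
  let b := v.isUnitSMul (w := fun i => (Real.sqrt (ip (v i) (v i)))⁻¹)
    fun i => (inv_ne_zero (Real.sqrt_pos.mpr (hvpos i)).ne').isUnit
  have hb : ∀ i j, ip (b i) (b j) = if i = j then 1 else 0 := by
    intro i j
    simp only [b, Module.Basis.isUnitSMul_apply, map_smul, LinearMap.smul_apply, smul_eq_mul]
    split_ifs with hij
    · subst hij
      have h1 := Real.mul_self_sqrt (hvpos i).le
      have h2 := (Real.sqrt_pos.mpr (hvpos i)).ne'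
      field_simp
      rw [pow_two, h1]
    · have : ip (v i) (v j) = 0 := hv hij
      rw [this]; simp
  refine ⟨b, fun i x => ?_⟩
  have h := congrArg (ip (b i)) (b.sum_repr x)
  simp only [map_sum, map_smul, hb, smul_eq_mul, mul_ite, mul_one, mul_zero, Finset.sum_ite_eq,
    Finset.mem_univ, if_true] at h
  exact h

/-! ### The invariant inner product and the exponential on `𝔭`. -/

namespace ReductiveStructure

variable {E : Type*} [NormedAddCommGroup E] [NormedSpace ℝ E]
  {G : Type*} [TopologicalSpace G] [ChartedSpace E G] [Group G] (R : ReductiveStructure E G)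

/-- The differential of the Cartan involution, on the model space. -/
noncomputable def dθ : E →L[ℝ] E := modelDeriv E E R.θ 1

/-- The invariant form, on the model space. -/
noncomputable def form : LinearMap.BilinForm ℝ E := R.B

/-- The subspace `𝔭` of the model space. -/
noncomputable def modelP : Submodule ℝ E := R.𝔭

/-- The inner product `(u, v) ↦ -B(u, θ v)`. -/
noncomputable def ip : LinearMap.BilinForm ℝ E := -(R.form.compRight (R.dθ : E →ₗ[ℝ] E))

theorem ip_apply (u v : E) : R.ip u v = -R.form u (R.dθ v) := rfl

theorem mem_modelP {a : E} : a ∈ R.modelP ↔ R.dθ a = -a := Iff.rfl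

theorem form_symm (u v : E) : R.form u v = R.form v u := R.B_symm u v

theorem form_modelAd (g : G) (u v : E) : R.form (modelAd E g u) (modelAd E g v) = R.form u v :=
  R.B_Ad g u v

theorem form_dθ (u v : E) : R.form (R.dθ u) (R.dθ v) = R.form u v := R.B_θ u v

theorem form_pos {u : E} (h : R.dθ u = -u) (hu : u ≠ 0) : 0 < R.form u u := R.B_pos u h hu

theorem form_neg {u : E} (h : R.dθ u = u) (hu : u ≠ 0) : R.form u u < 0 := R.B_neg u h hu

theorem dθ_dθ (u : E) : R.dθ (R.dθ u) = u := by
  have h := modelDeriv_comp (g := R.θ) (f := R.θ) (x := 1) (map_one R.θ)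
    (R.θ_smooth.mdifferentiable (by simp) _) (R.θ_smooth.mdifferentiable (by simp) _)
  simp only [R.θ_involutive] at h
  rw [modelDeriv_id] at h
  exact (congrArg (fun L : E →L[ℝ] E => L u) h).symm

theorem ip_symm (u v : E) : R.ip u v = R.ip v u := by
  rw [ip_apply, ip_apply, ← R.form_dθ u, dθ_dθ, form_symm]

theorem ip_pos {u : E} (hu : u ≠ 0) : 0 < R.ip u u := by
  set p := u - R.dθ u with hp
  set k := u + R.dθ u with hk
  have hθp : R.dθ p = -p := by rw [hp, map_sub, dθ_dθ, neg_sub]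
  have hθk : R.dθ k = k := by rw [hk, map_add, dθ_dθ, add_comm]
  -- Polarization along the `𝔭` and `𝔨` components (twice those of `u`), on which `B` has opposite
  -- signs.
  have hid : 4 * R.ip u u = R.form p p - R.form k k := by
    simp only [hp, hk, ip_apply, map_sub, map_add, LinearMap.sub_apply, LinearMap.add_apply]
    rw [R.form_symm (R.dθ u) u]
    ring
  have hk0 : R.form k k ≤ 0 := by
    by_cases h : k = 0
    · simp [h]
    · exact (R.form_neg hθk h).le
  have hp0 : 0 ≤ R.form p p := by
    by_cases h : p = 0
    · simp [h]
    · exact (R.form_pos hθp h).le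
  by_cases h : p = 0
  · have hkne : k ≠ 0 := by
      intro h'
      apply hu
      have : (2 : ℝ) • u = p + k := by rw [hp, hk, two_smul]; abel
      rw [h, h', add_zero] at this
      exact (smul_eq_zero.mp this).resolve_left two_ne_zero
    linarith [R.form_neg hθk hkne]
  · linarith [R.form_pos hθp h]

theorem eq_zero_of_ip_self {u : E} (h : R.ip u u = 0) : u = 0 := by
  by_contra hu
  exact (R.ip_pos hu).ne' h

theorem ip_self_nonneg (u : E) : 0 ≤ R.ip u u := by
  by_cases h : u = 0
  · simp [h]
  · exact (R.ip_pos h).le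

variable [LieGroup 𝓘(ℝ, E) ∞ G]

theorem dθ_modelAd (g : G) (u : E) : R.dθ (modelAd E g u) = modelAd E (R.θ g) (R.dθ u) :=
  congrArg (fun L : E →L[ℝ] E => L u) (modelDeriv_comp_modelAd R.θ R.θ_smooth g)

theorem modelAd_mul_apply (g h : G) (u : E) :
    modelAd E (g * h) u = modelAd E g (modelAd E h u) := by
  rw [modelAd_mul]; rfl

omit [LieGroup 𝓘(ℝ, E) ∞ G] in
theorem modelAd_one_apply (u : E) : modelAd E (1 : G) u = u := by
  rw [modelAd_one]; rfl

theorem ip_modelAd (g : G) (u v : E) :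
    R.ip u (modelAd E g v) = R.ip (modelAd E (R.θ g)⁻¹ u) v := by
  rw [ip_apply, ip_apply, dθ_modelAd, ← R.form_modelAd (R.θ g) _ (R.dθ v), ← modelAd_mul_apply,
    mul_inv_cancel, modelAd_one_apply]

/-- Every vector of `𝔭` is the velocity of a one-parameter subgroup. -/
theorem isOneParam_modelExp {a : E} (ha : a ∈ R.modelP) :
    IsOneParam (fun t : ℝ => modelExp G (t • a)) a := by
  have hex : ∃ φ : ℝ → G, IsOneParam φ a := by
    -- No differential equation is needed: without a one-parameter subgroup `lieExp a` takes its
    -- default value `1 = lieExp 0`, and injectivity of the Cartan decomposition gives `a = 0`,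
    -- whose one-parameter subgroup is constant.
    by_contra hcon
    have h1 : modelExp G a = 1 := dif_neg hcon
    have h0 : modelExp G (0 : E) = 1 := IsOneParam.const.modelExp_eq
    have h2 := R.cartan_decomposition.injective (a₁ := (⟨1, map_one R.θ⟩, ⟨a, ha⟩))
      (a₂ := (⟨1, map_one R.θ⟩, ⟨(0 : E), R.modelP.zero_mem⟩))
      (congrArg (fun g => (1 : G) * g) (h1.trans h0.symm))
    have h3 : a = 0 := congrArg (fun x => (x.2.1 : E)) h2
    exact hcon ⟨_, h3 ▸ IsOneParam.const⟩
  obtain ⟨φ, hφ⟩ := hex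
  have : φ = fun t : ℝ => modelExp G (t • a) := funext hφ.eq_modelExp
  exact this ▸ hφ

theorem modelAd_mem_modelP {k : G} (hk : R.θ k = k) {a : E} (ha : a ∈ R.modelP) :
    modelAd E k a ∈ R.modelP := by
  rw [mem_modelP, dθ_modelAd, hk, R.mem_modelP.mp ha, map_neg]

theorem conj_modelExp (k : G) {a : E} (ha : a ∈ R.modelP) :
    k * modelExp G a * k⁻¹ = modelExp G (modelAd E k a) := by
  rw [((R.isOneParam_modelExp ha).conj k).modelExp_eq, one_smul]

theorem θ_modelExp {a : E} (ha : a ∈ R.modelP) : R.θ (modelExp G a) = modelExp G (-a) := by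
  have h := ((R.isOneParam_modelExp ha).comp_hom (map_mul R.θ) R.θ_smooth).modelExp_eq
  rw [one_smul] at h
  rw [← h]
  exact congrArg (modelExp G) (R.mem_modelP.mp ha)

theorem modelExp_add_smul {a : E} (ha : a ∈ R.modelP) (s t : ℝ) :
    modelExp G ((s + t) • a) = modelExp G (s • a) * modelExp G (t • a) :=
  (R.isOneParam_modelExp ha).map_add s t

theorem modelExp_neg {a : E} (ha : a ∈ R.modelP) : modelExp G (-a) = (modelExp G a)⁻¹ := by
  simpa using (R.isOneParam_modelExp ha).map_neg 1

theorem ip_modelAd_modelExp {a : E} (ha : a ∈ R.modelP) (u v : E) :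
    R.ip u (modelAd E (modelExp G a) v) = R.ip (modelAd E (modelExp G a) u) v := by
  rw [ip_modelAd, R.θ_modelExp ha, R.modelExp_neg ha, inv_inv]

variable [PreconnectedSpace G]

/-- If `Ad (e^a)` commutes with `Ad (e^b)` for all `b ∈ 𝔭` then it fixes `𝔭`. -/
theorem modelAd_modelExp_eq_self {a b : E} (ha : a ∈ R.modelP) (hb : b ∈ R.modelP)
    (hcomm : ∀ t : ℝ, Commute (modelAd E (modelExp G a)) (modelAd E (modelExp G (t • b)))) :
    modelAd E (modelExp G a) b = b := by
  set e := modelExp G a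
  have hφ := R.isOneParam_modelExp hb
  set φ : ℝ → G := fun t => modelExp G (t • b)
  have hcen : ∀ t g, (e * φ t * e⁻¹ * (φ t)⁻¹) * g = g * (e * φ t * e⁻¹ * (φ t)⁻¹) := by
    intro t
    refine commute_of_modelAd_eq_id (E := E) ?_
    have h1 : modelAd E (e * φ t) = modelAd E (φ t * e) := by
      rw [modelAd_mul, modelAd_mul]; exact hcomm t
    have h2 : e * φ t * e⁻¹ * (φ t)⁻¹ = (e * φ t) * (φ t * e)⁻¹ := by group
    rw [h2, modelAd_mul, h1, ← modelAd_mul, mul_inv_cancel, modelAd_one]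
  -- These commutators are central, so their velocity `ζ = Ad(e) b - b` is fixed by `Ad`. Since `Ad
  -- e` is symmetric, `ζ` is orthogonal to `Ad(e) b - b`, that is, to itself.
  have hz : IsOneParam (fun t => e * φ t * e⁻¹ * (φ t)⁻¹) (modelAd E e b + -b) := by
    refine (hφ.conj e).mul hφ.inv fun s t => ?_
    have hst : Commute (φ s) (φ t)⁻¹ := by
      refine Commute.inv_right ?_
      rw [Commute, SemiconjBy, ← hφ.map_add, add_comm, hφ.map_add]
    have h1 : e * φ s * e⁻¹ = (e * φ s * e⁻¹ * (φ s)⁻¹) * φ s := by group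
    rw [h1]
    exact Commute.mul_left (hcen s _) hst
  set ζ := modelAd E e b + -b with hζ
  have hfix : ∀ x : G, modelAd E x ζ = ζ := by
    intro x
    have h1 := (hz.conj x).velocity
    have h2 : (fun t => x * (e * φ t * e⁻¹ * (φ t)⁻¹) * x⁻¹)
        = fun t => e * φ t * e⁻¹ * (φ t)⁻¹ := by
      funext t
      rw [← hcen t x, mul_inv_cancel_right]
    rw [h2, hz.velocity] at h1
    exact h1.symm
  have h0 : R.ip ζ ζ = 0 := by
    conv_lhs => enter [2]; rw [hζ]
    rw [map_add, R.ip_modelAd_modelExp ha, hfix, map_neg, add_neg_cancel]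
  have := R.eq_zero_of_ip_self h0
  rw [hζ, ← sub_eq_add_neg] at this
  exact sub_eq_zero.mp this

/-- If `Ad (e^a)` commutes with `Ad (e^b)` for all `b ∈ 𝔭` then it is trivial. -/
theorem modelAd_modelExp_eq_id {a : E} (ha : a ∈ R.modelP)
    (hcomm : ∀ b ∈ R.modelP, Commute (modelAd E (modelExp G a)) (modelAd E (modelExp G b))) :
    modelAd E (modelExp G a) = ContinuousLinearMap.id ℝ E := by
  set e := modelExp G a with he
  have hP : ∀ b ∈ R.modelP, modelAd E e b = b := fun b hb =>
    R.modelAd_modelExp_eq_self ha hb fun t => hcomm _ (R.modelP.smul_mem t hb)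
  have hinv : ∀ u, modelAd E e⁻¹ (modelAd E e u) = u := fun u => by
    rw [← modelAd_mul_apply, inv_mul_cancel, modelAd_one_apply]
  have hinv' : ∀ u, modelAd E e (modelAd E e⁻¹ u) = u := fun u => by
    rw [← modelAd_mul_apply, mul_inv_cancel, modelAd_one_apply]
  have hθe : R.θ e = e⁻¹ := by rw [he, R.θ_modelExp ha, R.modelExp_neg ha]
  have hsym := R.ip_modelAd_modelExp ha
  have hsym' : ∀ u v, R.ip u (modelAd E e⁻¹ v) = R.ip (modelAd E e⁻¹ u) v := fun u v => by
    rw [ip_modelAd, map_inv, hθe, inv_inv]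
  have hK : ∀ u, R.dθ u = u → modelAd E e u = u := by
    intro u hu
    -- For `u ∈ 𝔨` this difference lies in `𝔭`, hence is fixed by `Ad e`, and symmetry makes it
    -- orthogonal to itself. So `(Ad e)² u = u`, and positivity of `Ad e`, the square of a symmetric
    -- operator, excludes the eigenvalue `-1`.
    set p := modelAd E e u - modelAd E e⁻¹ u with hp
    have hpP : p ∈ R.modelP := by
      rw [mem_modelP, hp, map_sub, dθ_modelAd, dθ_modelAd, map_inv, hθe, hu, inv_inv, neg_sub]
    have hp' : modelAd E e⁻¹ p = p := by
      conv_lhs => rw [← hP p hpP]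
      exact hinv p
    have hp0 : p = 0 := by
      refine R.eq_zero_of_ip_self ?_
      conv_lhs => enter [2]; rw [hp]
      rw [map_sub, hsym, hP p hpP, hsym', hp', sub_self]
    have hsq : modelAd E e (modelAd E e u) = u := by
      rw [sub_eq_zero.mp hp0, hinv']
    set w := modelAd E e u - u with hw
    have hTw : modelAd E e w = -w := by rw [hw, map_sub, hsq, neg_sub]
    have hhalf : (1 / 2 : ℝ) • a ∈ R.modelP := R.modelP.smul_mem _ ha
    have hH : e = modelExp G ((1 / 2 : ℝ) • a) * modelExp G ((1 / 2 : ℝ) • a) := by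
      rw [← R.modelExp_add_smul ha]
      norm_num
      rfl
    have h1 : R.ip w (modelAd E e w) = R.ip (modelAd E (modelExp G ((1 / 2 : ℝ) • a)) w)
        (modelAd E (modelExp G ((1 / 2 : ℝ) • a)) w) := by
      rw [hH, modelAd_mul_apply, R.ip_modelAd_modelExp hhalf]
    rw [hTw, map_neg] at h1
    have h2 := R.ip_self_nonneg (modelAd E (modelExp G ((1 / 2 : ℝ) • a)) w)
    have h3 := R.ip_self_nonneg w
    exact sub_eq_zero.mp (R.eq_zero_of_ip_self (u := w) (by linarith))
  refine ContinuousLinearMap.ext fun u => ?_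
  have hu : u = (1 / 2 : ℝ) • ((u + R.dθ u) + (u - R.dθ u)) := by
    rw [add_add_sub_cancel, ← two_smul ℝ u, smul_smul]
    norm_num
  have h1 := hK (u + R.dθ u) (by rw [map_add, dθ_dθ, add_comm])
  have h2 := hP (u - R.dθ u) (by rw [mem_modelP, map_sub, dθ_dθ, neg_sub])
  rw [ContinuousLinearMap.id_apply]
  conv_lhs => rw [hu, map_smul, map_add, h1, h2]
  exact hu.symm

end ReductiveStructure

/-! ### The adjoint representation as a linearized Cartan decomposition. -/

namespace ReductiveStructure

variable {E : Type*} [NormedAddCommGroup E] [NormedSpace ℝ E] [FiniteDimensional ℝ E]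
  {G : Type*} [TopologicalSpace G] [PreconnectedSpace G] [ChartedSpace E G] [Group G]
  [LieGroup 𝓘(ℝ, E) ∞ G] (R : ReductiveStructure E G)

/-- The adjoint representation of a reductive group, written in an orthonormal basis for
`-B(·, θ ·)`, together with its Cartan decomposition. -/
theorem exists_linearizedCartan :
    ∃ L : LinearizedCartan G R.modelP (Fin (Module.finrank ℝ E)),
      L.θ = R.θ ∧ ∀ a, L.ex a = modelExp G (a : E) := by
  obtain ⟨b, hb⟩ := LinearMap.BilinForm.exists_orthonormal_basis (ip := R.ip) R.ip_symm
    (fun u hu => R.ip_pos hu)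
  let M : (E →L[ℝ] E) →ₗ[ℝ] Matrix (Fin (Module.finrank ℝ E)) (Fin (Module.finrank ℝ E)) ℝ :=
    (LinearMap.toMatrix b b).toLinearMap ∘ₗ ContinuousLinearMap.coeLM ℝ
  have hMmul : ∀ S T : E →L[ℝ] E, M (S.comp T) = M S * M T := fun S T =>
    LinearMap.toMatrix_comp b b b _ _
  have hMone : M (ContinuousLinearMap.id ℝ E) = 1 := LinearMap.toMatrix_id b
  have hMinj : Function.Injective M := fun S T h =>
    ContinuousLinearMap.coe_injective ((LinearMap.toMatrix b b).injective h)
  have hMapply : ∀ (S : E →L[ℝ] E) i j, M S i j = R.ip (b i) (S (b j)) := fun S i j =>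
    (LinearMap.toMatrix_apply b b _ i j).trans (hb i _)
  have hMcont : Continuous M := LinearMap.continuous_of_finiteDimensional M
  let ρ : G →* Matrix (Fin (Module.finrank ℝ E)) (Fin (Module.finrank ℝ E)) ℝ :=
    { toFun := fun g => M (modelAd E g)
      map_one' := by rw [modelAd_one, hMone]
      map_mul' := fun g h => by rw [modelAd_mul, hMmul] }
  have hρ : ∀ g, ρ g = M (modelAd E g) := fun _ => rfl
  have hdθ : M R.dθ * M R.dθ = 1 := by
    rw [← hMmul, ← hMone]
    exact congrArg M (ContinuousLinearMap.ext R.dθ_dθ)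
  have hcomm : ∀ g h : G, Commute (ρ g) (ρ h) → Commute (modelAd E g) (modelAd E h) := by
    intro g h hgh
    refine hMinj ?_
    exact (hMmul _ _).trans (hgh.eq.trans (hMmul _ _).symm)
  have hker : ∀ g : G, ρ g = 1 → modelAd E g = ContinuousLinearMap.id ℝ E := fun g hg =>
    hMinj (hg.trans hMone.symm)
  refine ⟨{
    θ := R.θ
    ex := fun a => modelExp G (a : E)
    ρ := ρ
    continuous_ρ := hMcont.comp continuous_modelAd
    ex_add_smul := fun s t a => R.modelExp_add_smul a.2 s t
    θ_ex := fun a => R.θ_modelExp a.2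
    conj_ex := fun k hk a => ⟨⟨_, R.modelAd_mem_modelP hk a.2⟩, R.conj_modelExp k a.2⟩
    isCompact_fixed := R.isCompact_fixed
    decomposition := R.cartan_decomposition
    ρ_transpose := fun g => ?_
    trace_θ := fun g => ?_
    commute_of_ρ_eq_one := fun z hz => commute_of_modelAd_eq_id (hker z hz)
    ex_add := fun v hv a => ?_
    ρ_ex_eq_one := fun a ha => ?_ }, rfl, fun _ => rfl⟩
  · ext i j
    rw [Matrix.transpose_apply, hρ, hρ, hMapply, hMapply, R.ip_modelAd, R.ip_symm]
  · have h1 : ρ (R.θ g) * M R.dθ = M R.dθ * ρ g := by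
      rw [hρ, hρ, ← hMmul, ← hMmul]
      exact congrArg M (modelDeriv_comp_modelAd R.θ R.θ_smooth g).symm
    -- The involution `dθ` intertwines `Ad g` and `Ad (θ g)`, so their traces agree.
    have h2 : ρ (R.θ g) = M R.dθ * ρ g * M R.dθ := by
      rw [← h1, mul_assoc, hdθ, mul_one]
    rw [h2, Matrix.trace_mul_comm, ← mul_assoc, hdθ, one_mul]
  · have hmul := (R.isOneParam_modelExp a.2).mul (R.isOneParam_modelExp v.2) fun s t =>
      Commute.symm (commute_of_modelAd_eq_id (E := E) (hker _ (hv t)) _)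
    have h := hmul.modelExp_eq
    simpa using h
  · refine (congrArg M (R.modelAd_modelExp_eq_id a.2 fun c hc => hcomm _ _ (ha ⟨c, hc⟩))).trans
      hMone

end ReductiveStructure

/-! ### Selberg's lemma. -/

theorem proposition2p9
    {E : Type*} [NormedAddCommGroup E] [NormedSpace ℝ E] [FiniteDimensional ℝ E]
    {G : Type*} [TopologicalSpace G] [T2Space G] [ConnectedSpace G]
    [ChartedSpace E G] [Group G] [LieGroup 𝓘(ℝ, E) ∞ G]
    (R : ReductiveStructure E G)
    (Γ : Subgroup G) (hdiscrete : DiscreteTopology Γ) (hcocompact : IsCocompactSubgroup Γ)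
    (γ : G) (hγ : γ ∈ Γ) :
    R.IsSemisimple γ ∧
      IsCocompactSubgroup (Γ.subgroupOf (Subgroup.centralizer {γ})) := by
  have : IsTopologicalGroup G := topologicalGroup_of_lieGroup 𝓘(ℝ, E) ∞
  have : ProperSpace E := FiniteDimensional.proper ℝ E
  have : LocallyCompactSpace G := ChartedSpace.locallyCompactSpace E G
  refine ⟨?_, hcocompact.centralizer hdiscrete hγ⟩
  obtain ⟨L, hθ, hex⟩ := R.exists_linearizedCartan
  obtain ⟨g, k, a, hk, hka, hγ⟩ := L.exists_conj_commuting_decomposition hdiscrete hcocompact hγ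
  have hkR : R.θ k = k := hθ ▸ hk
  have hcomm : k * L.ex a = L.ex a * k := hka.eq
  -- Commutation gives `e^{Ad(k) a} = e^a`; the exponential is injective on `𝔭` by the Cartan
  -- decomposition.
  have hfix : modelAd E k (a : E) = a := by
    have h1 := R.conj_modelExp k a.2
    rw [← hex, hcomm, mul_inv_cancel_right] at h1
    have h2 := L.eq_and_eq_of_mul_ex_eq (a' := ⟨_, R.modelAd_mem_modelP hkR a.2⟩)
      (map_one L.θ) (map_one L.θ)
      (congrArg (1 * ·) (h1.trans (hex ⟨_, R.modelAd_mem_modelP hkR a.2⟩).symm))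
    exact (congrArg Subtype.val h2.2).symm
  have hfix' : modelAd E k⁻¹ (a : E) = a := by
    conv_lhs => rw [← hfix]
    rw [← ReductiveStructure.modelAd_mul_apply, inv_mul_cancel,
      ReductiveStructure.modelAd_one_apply]
  -- The witness is `k⁻¹` because semisimplicity is phrased with `e^a k⁻¹`, whereas here `γ` is
  -- conjugate to `k e^a = e^a k`.
  refine ⟨g, (a : E), a.2, k⁻¹, R.K.inv_mem hkR, hfix', ?_⟩
  rw [hγ, hcomm, inv_inv, hex]
  rfl
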